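/- Link diagrams and tangle diagrams are unoriented and planar, and $\det(D)=|V_L(-1)|=|\Delta_L(-1)|$ denotes the determinant of the link $L$ with diagram $D$. A tangle diagram lies in a disk, with endpoints NW, NE, SE, SW in clockwise order on the boundary circle, and consists of two arcs and possibly closed curves. Its numerator $n(T)$ joins NW to NE and SW to SE, its denominator $d(T)$ joins NW to SW and NE to SE, and $S+T$ is the horizontal sum with $S$ on the left. The tangle $0$ is the pair of horizontal arcs, $\infty$ the pair of vertical arcs, and $1$ (resp. $-1$) is the single crossing whose overstrand has positive (resp. negative) slope. (1) Let $D$ be a link diagram and $c$ a crossing of $D$ such that the crossing change at $c$ turns $D$ into an alternating diagram (so $D$ is almost alternating with dealternator $c$). View $c$ as the tangle $-1$ and let $D^c_0$, $D^c_\infty$ be the diagrams obtained by replacing it with the tangles $0$ and $\infty$. Then $$\det(D)=\left|\det(D^c_0)-\det(D^c_\infty)\right|.$$ (2) Let $T$ be an alternating tangle diagram (over- and undercrossings alternate along every strand), which, if it is connected, is of type 1: the strand starting at NW passes below at the first crossing that it meets. Let $\alpha,\beta\ge 1$ be coprime integers. For a rational number $q$, a standard diagram of the rational tangle $q$ is the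 diagram $[a_1,\dots,a_k]$ given by a continued fraction $q=a_1+\frac{1}{a_2+\cdots+\frac1{a_k}}$ with integers $a_1,\dots,a_k$ all of the same sign and $a_2,\dots,a_k\neq 0$ ($a_1=0$ being allowed): starting from the innermost term, one alternately adds rows of $|a_i|$ horizontal twists on the right and columns of $|a_i|$ vertical twists at the bottom, all crossings having the common sign, and $a_1$ being horizontal. Then, for all standard diagrams of the rational tangles $\frac{\alpha}{\beta}$ and $-\frac{\alpha}{\beta}$, $$\det\left(n\left(\tfrac{\alpha}{\beta}+T\right)\right)=\beta\det(n(T))+\alpha\det(d(T)),$$ $$\det\left(n\left(-\tfrac{\alpha}{\beta}+T\right)\right)=\left|\beta\det(n(T))-\alpha\det(d(T))\right|.$$ -/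

import Mathlib

/-- The four endpoints of a tangle diagram on the boundary circle of the projection disk. -/
inductive Endpoint : Type
  | NW | NE | SE | SW
  deriving DecidableEq

/-- The ends of the edges of a diagram: a crossing has four of them, numbered `0, 1, 2, 3`
counterclockwise; a joint (a marked point in the middle of a strand) has two; an endpoint has one. -/
inductive Dart (C J E : Type) : Type
  | crossing (c : C) (i : ZMod 4)
  | joint (j : J) (b : Bool)
  | endpoint (x : E)
  deriving DecidableEq

/-- A diagram with set of endpoints `E`, given by its combinatorial data: crossings, joints, the
fixed point free involution `edge` matching the two ends of each edge, and the over/under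
information.  Joints are two-valent vertices through which a strand passes straight; they make
it possible to glue diagrams end to end, and a circle without crossings is a cycle of joints.
Over/under: if `oddOver c = true` the ends `1, 3` of `c` belong to the overstrand, otherwise the ends
`0, 2` do. Planarity is the separate condition `IsPlanar`. -/
structure Diagram (E : Type) : Type 1 where
  Crossing : Type
  Joint : Type
  [fintypeCrossing : Fintype Crossing]
  [decEqCrossing : DecidableEq Crossing]
  [fintypeJoint : Fintype Joint]
  [decEqJoint : DecidableEq Joint]
  edge : Dart Crossing Joint E → Dart Crossing Joint E
  edge_edge : ∀ d, edge (edge d) = d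
  edge_ne : ∀ d, edge d ≠ d
  oddOver : Crossing → Bool

attribute [instance] Diagram.fintypeCrossing Diagram.decEqCrossing
  Diagram.fintypeJoint Diagram.decEqJoint

/-- Link diagrams have no endpoints. -/
abbrev LinkDiagram : Type 1 := Diagram Empty

/-- Tangle diagrams have the four endpoints NW, NE, SE, SW. -/
abbrev TangleDiagram : Type 1 := Diagram Endpoint

/-- The number of classes of the equivalence relation generated by `x ∼ f x` for `f ∈ S`. -/
noncomputable def numOrbits {α : Type} (S : Set (α → α)) : ℕ :=
  Nat.card (Quot fun x y : α => ∃ f ∈ S, f x = y)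

namespace Diagram

variable {E : Type}

/-- Counterclockwise rotation around the vertices; `ρ` is the prescribed rotation of endpoints. -/
def rot (D : Diagram E) (ρ : E → E) :
    Dart D.Crossing D.Joint E → Dart D.Crossing D.Joint E
  | .crossing c i => .crossing c (i + 1)
  | .joint j b => .joint j (!b)
  | .endpoint x => .endpoint (ρ x)

/-- Euler's formula `V + F = E + 2 c` (`c` the number of connected components) for the
combinatorial map with rotation `D.rot ρ`: all its components have genus zero. -/
def EulerFormula (D : Diagram E) (ρ : E → E) : Prop :=
  numOrbits {D.rot ρ} + numOrbits {D.rot ρ ∘ D.edge} =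
    numOrbits {D.edge} + 2 * numOrbits {D.rot ρ, D.edge}

/-- The diagram, with its endpoints, is connected as a subset of the plane. -/
def IsConnected (D : Diagram E) : Prop :=
  numOrbits {D.rot id, D.edge} = 1

/-- `D.Leads d d'`: leaving `d` along its edge, and going straight through any joints that are
met, one arrives at `d'`. -/
inductive Leads (D : Diagram E) (d : Dart D.Crossing D.Joint E) :
    Dart D.Crossing D.Joint E → Prop
  | edge : Leads D d (D.edge d)
  | through (j : D.Joint) (b : Bool) :
      Leads D d (.joint j b) → Leads D d (D.edge (.joint j (!b)))

/-- The end `i` of the crossing `c` belongs to the overstrand. -/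
def IsOver (D : Diagram E) (c : D.Crossing) (i : ZMod 4) : Prop :=
  Odd i.val ↔ D.oddOver c = true

/-- Over- and undercrossings alternate along all strands of the diagram. -/
def IsAlternating (D : Diagram E) : Prop :=
  ∀ (c c' : D.Crossing) (i i' : ZMod 4),
    D.Leads (.crossing c i) (.crossing c' i') → (D.IsOver c i ↔ ¬ D.IsOver c' i')

/-- The crossing change at `c`. -/
def crossingChange (D : Diagram E) (c : D.Crossing) : Diagram E :=
  { D with oddOver := Function.update D.oddOver c (!D.oddOver c) }

/-- The end to which the end `i` of a crossing is joined when the crossing is smoothed: `true` is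
the smoothing that joins `0` to `1` and `2` to `3`, `false` the one that joins `1` to `2` and `3`
to `0`. -/
def partner (b : Bool) (i : ZMod 4) : ZMod 4 :=
  if (Even i.val ↔ b = true) then i + 1 else i - 1

/-- The four ends of a crossing as the ends of the two strands of the smoothing `b`
(see `partner`): the first component is the strand, the second one its end. -/
def smoothEnd (b : Bool) (i : ZMod 4) : Bool × Bool :=
  let k : ℕ := (if b then i else i - 1).val
  (decide (2 ≤ k), decide (k % 2 = 1))

/-- The end with a given label in the smoothing `b`. -/
def smoothEndInv (b : Bool) (x : Bool × Bool) : ZMod 4 :=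
  let k : ZMod 4 := (if x.1 then 2 else 0) + (if x.2 then 1 else 0)
  if b then k else k + 1

theorem smoothEndInv_smoothEnd : ∀ (b : Bool) (i : ZMod 4),
    smoothEndInv b (smoothEnd b i) = i := by
  decide

theorem smoothEnd_smoothEndInv : ∀ (b : Bool) (x : Bool × Bool),
    smoothEnd b (smoothEndInv b x) = x := by
  decide

/-- The ends in a diagram and in its smoothing `b` at `c`, where the crossing `c` is replaced by two
joints. -/
def smoothEquiv (D : Diagram E) (c : D.Crossing) (b : Bool) :
    Dart D.Crossing D.Joint E ≃ Dart {x : D.Crossing // x ≠ c} (D.Joint ⊕ Bool) E where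
  toFun
    | .crossing x i =>
        if h : x = c then .joint (.inr (smoothEnd b i).1) (smoothEnd b i).2
        else .crossing ⟨x, h⟩ i
    | .joint j e => .joint (.inl j) e
    | .endpoint x => .endpoint x
  invFun
    | .crossing x i => .crossing x.1 i
    | .joint (.inl j) e => .joint j e
    | .joint (.inr s) e => .crossing c (smoothEndInv b (s, e))
    | .endpoint x => .endpoint x
  left_inv := by
    rintro (⟨x, i⟩ | ⟨j, e⟩ | x)
    · by_cases h : x = c
      · subst h
        simp [smoothEndInv_smoothEnd]
      · simp [h]
    · rfl
    · rfl
  right_inv := by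
    rintro (⟨⟨x, h⟩, i⟩ | ⟨j | s, e⟩ | x)
    · simp [h]
    · rfl
    · simp [smoothEnd_smoothEndInv]
    · rfl

/-- The diagram obtained by the smoothing `b` at the crossing `c`. -/
def smooth (D : Diagram E) (c : D.Crossing) (b : Bool) : Diagram E where
  Crossing := {x : D.Crossing // x ≠ c}
  Joint := D.Joint ⊕ Bool
  edge d := D.smoothEquiv c b (D.edge ((D.smoothEquiv c b).symm d))
  edge_edge d := by simp [D.edge_edge]
  edge_ne d h := by
    rw [← Equiv.eq_symm_apply] at h
    exact D.edge_ne _ h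
  oddOver x := D.oddOver x.1

/-- The smoothing `D^c_0`. The crossing `c` is seen as the tangle `-1`, whose overstrand runs
from NW to SE, and is replaced by the tangle `0` (NW joined to NE and SW to SE). -/
def smoothZero (D : Diagram E) (c : D.Crossing) : Diagram E := D.smooth c (D.oddOver c)

/-- The smoothing `D^c_∞`. The crossing `c` is seen as the tangle `-1` and replaced by the
tangle `∞` (NW joined to SW and NE to SE). -/
def smoothInfty (D : Diagram E) (c : D.Crossing) : Diagram E := D.smooth c (!D.oddOver c)

end Diagram

namespace LinkDiagram

/-- The link diagram lies in the plane. -/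
def IsPlanar (D : LinkDiagram) : Prop := D.EulerFormula id

/-- `c` is a dealternator: the crossing change at `c` makes the diagram alternating. -/
def IsDealternator (D : LinkDiagram) (c : D.Crossing) : Prop :=
  (D.crossingChange c).IsAlternating

/-- A Kauffman state `s` chooses a smoothing at each crossing, `true` being the `A`-smoothing: it
joins the two regions swept out when the overstrand turns counterclockwise to the understrand.
This map sends an end of an edge to the one to which it is then connected. -/
def statePartner (D : LinkDiagram) (s : D.Crossing → Bool) :
    Dart D.Crossing D.Joint Empty → Dart D.Crossing D.Joint Empty
  | .crossing c i => .crossing c (Diagram.partner (s c == D.oddOver c) i)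
  | .joint j b => .joint j (!b)
  | .endpoint x => .endpoint x

/-- The number of circles of a Kauffman state. -/
noncomputable def loops (D : LinkDiagram) (s : D.Crossing → Bool) : ℕ :=
  numOrbits {D.statePartner s, D.edge}

/-- The Kauffman bracket `∑ₛ A ^ (a(s) - b(s)) * (-A² - A⁻²) ^ (loops s - 1)` at a complex
number `A`; it is `1` on the circle without crossings. -/
noncomputable def bracket (D : LinkDiagram) (A : ℂ) : ℂ :=
  ∑ s : D.Crossing → Bool,
    A ^ (∑ c, if s c then (1 : ℤ) else -1) * (-A ^ 2 - (A⁻¹) ^ 2) ^ (D.loops s - 1)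

/-- The determinant `|V(-1)|` (which is `|Δ(-1)|`) of the link with diagram `D`: the Jones
polynomial is `V(t) = (-A) ^ (-3 w) * bracket D A` with `t = A ^ (-4)` and `w` the writhe, and
`t = -1` for `A = exp (π i / 4)`, where the factor `(-A) ^ (-3 w)` has absolute value one. -/
noncomputable def det (D : LinkDiagram) : ℝ :=
  ‖D.bracket (Complex.exp (Real.pi / 4 * Complex.I))‖

end LinkDiagram

namespace TangleDiagram

open Endpoint

/-- The cyclic order of the endpoints, clockwise as seen in the projection disk. -/
def clockwise : Endpoint → Endpoint
  | NW => NE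
  | NE => SE
  | SE => SW
  | SW => NW

/-- The tangle diagram lies in the projection disk, with NW, NE, SE, SW in clockwise order on the
boundary circle. The complementary disk is shrunk to a four-valent vertex, around which
the counterclockwise order on the sphere is the clockwise order on the boundary of the
projection disk. -/
def IsPlanar (T : TangleDiagram) : Prop := T.EulerFormula clockwise

/-- Type 1: the strand starting at NW passes below at the first crossing that it meets. -/
def IsType1 (T : TangleDiagram) : Prop :=
  ∃ (c : T.Crossing) (i : ZMod 4), T.Leads (.endpoint NW) (.crossing c i) ∧ ¬ T.IsOver c i

/-- The numerator closure turns NW, NE into the ends of one joint and SW, SE into those of another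
one. -/
def numeratorEquiv (C J : Type) : Dart C J Endpoint ≃ Dart C (J ⊕ Bool) Empty where
  toFun
    | .crossing c i => .crossing c i
    | .joint j b => .joint (.inl j) b
    | .endpoint NW => .joint (.inr false) false
    | .endpoint NE => .joint (.inr false) true
    | .endpoint SW => .joint (.inr true) false
    | .endpoint SE => .joint (.inr true) true
  invFun
    | .crossing c i => .crossing c i
    | .joint (.inl j) b => .joint j b
    | .joint (.inr false) false => .endpoint NW
    | .joint (.inr false) true => .endpoint NE
    | .joint (.inr true) false => .endpoint SW
    | .joint (.inr true) true => .endpoint SE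
  left_inv := by rintro (_ | _ | (_ | _ | _ | _)) <;> rfl
  right_inv := by rintro (_ | ⟨_ | (_ | _), (_ | _)⟩ | ⟨⟨⟩⟩) <;> rfl

/-- The denominator closure turns NW, SW into the ends of one joint and NE, SE into those of
another one. -/
def denominatorEquiv (C J : Type) : Dart C J Endpoint ≃ Dart C (J ⊕ Bool) Empty where
  toFun
    | .crossing c i => .crossing c i
    | .joint j b => .joint (.inl j) b
    | .endpoint NW => .joint (.inr false) false
    | .endpoint SW => .joint (.inr false) true
    | .endpoint NE => .joint (.inr true) false
    | .endpoint SE => .joint (.inr true) true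
  invFun
    | .crossing c i => .crossing c i
    | .joint (.inl j) b => .joint j b
    | .joint (.inr false) false => .endpoint NW
    | .joint (.inr false) true => .endpoint SW
    | .joint (.inr true) false => .endpoint NE
    | .joint (.inr true) true => .endpoint SE
  left_inv := by rintro (_ | _ | (_ | _ | _ | _)) <;> rfl
  right_inv := by rintro (_ | ⟨_ | (_ | _), (_ | _)⟩ | ⟨⟨⟩⟩) <;> rfl

/-- The numerator `n(T)`. -/
def numerator (T : TangleDiagram) : LinkDiagram where
  Crossing := T.Crossing
  Joint := T.Joint ⊕ Bool
  edge d := numeratorEquiv _ _ (T.edge ((numeratorEquiv _ _).symm d))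
  edge_edge d := by simp [T.edge_edge]
  edge_ne d h := by
    rw [← Equiv.eq_symm_apply] at h
    exact T.edge_ne _ h
  oddOver := T.oddOver

/-- The denominator `d(T)`. -/
def denominator (T : TangleDiagram) : LinkDiagram where
  Crossing := T.Crossing
  Joint := T.Joint ⊕ Bool
  edge d := denominatorEquiv _ _ (T.edge ((denominatorEquiv _ _).symm d))
  edge_edge d := by simp [T.edge_edge]
  edge_ne d h := by
    rw [← Equiv.eq_symm_apply] at h
    exact T.edge_ne _ h
  oddOver := T.oddOver

/-- Horizontal juxtaposition, left tangle first: NE, SE of the left tangle are joined to NW, SW of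
the right one. -/
def addEquiv (C J C' J' : Type) :
    Dart C J Endpoint ⊕ Dart C' J' Endpoint ≃
      Dart (C ⊕ C') ((J ⊕ J') ⊕ Bool) Endpoint where
  toFun
    | .inl (.crossing c i) => .crossing (.inl c) i
    | .inr (.crossing c i) => .crossing (.inr c) i
    | .inl (.joint j b) => .joint (.inl (.inl j)) b
    | .inr (.joint j b) => .joint (.inl (.inr j)) b
    | .inl (.endpoint NW) => .endpoint NW
    | .inl (.endpoint SW) => .endpoint SW
    | .inr (.endpoint NE) => .endpoint NE
    | .inr (.endpoint SE) => .endpoint SE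
    | .inl (.endpoint NE) => .joint (.inr false) false
    | .inr (.endpoint NW) => .joint (.inr false) true
    | .inl (.endpoint SE) => .joint (.inr true) false
    | .inr (.endpoint SW) => .joint (.inr true) true
  invFun
    | .crossing (.inl c) i => .inl (.crossing c i)
    | .crossing (.inr c) i => .inr (.crossing c i)
    | .joint (.inl (.inl j)) b => .inl (.joint j b)
    | .joint (.inl (.inr j)) b => .inr (.joint j b)
    | .endpoint NW => .inl (.endpoint NW)
    | .endpoint SW => .inl (.endpoint SW)
    | .endpoint NE => .inr (.endpoint NE)
    | .endpoint SE => .inr (.endpoint SE)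
    | .joint (.inr false) false => .inl (.endpoint NE)
    | .joint (.inr false) true => .inr (.endpoint NW)
    | .joint (.inr true) false => .inl (.endpoint SE)
    | .joint (.inr true) true => .inr (.endpoint SW)
  left_inv := by rintro ((_ | _ | (_ | _ | _ | _)) | (_ | _ | (_ | _ | _ | _))) <;> rfl
  right_inv := by
    rintro (⟨_ | _, _⟩ | ⟨(_ | _) | (_ | _), (_ | _)⟩ | (_ | _ | _ | _)) <;> rfl

/-- Vertical juxtaposition, upper tangle first: SW, SE of the upper tangle are joined to NW, NE of
the lower one. -/
def mulEquiv (C J C' J' : Type) :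
    Dart C J Endpoint ⊕ Dart C' J' Endpoint ≃
      Dart (C ⊕ C') ((J ⊕ J') ⊕ Bool) Endpoint where
  toFun
    | .inl (.crossing c i) => .crossing (.inl c) i
    | .inr (.crossing c i) => .crossing (.inr c) i
    | .inl (.joint j b) => .joint (.inl (.inl j)) b
    | .inr (.joint j b) => .joint (.inl (.inr j)) b
    | .inl (.endpoint NW) => .endpoint NW
    | .inl (.endpoint NE) => .endpoint NE
    | .inr (.endpoint SW) => .endpoint SW
    | .inr (.endpoint SE) => .endpoint SE
    | .inl (.endpoint SW) => .joint (.inr false) false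
    | .inr (.endpoint NW) => .joint (.inr false) true
    | .inl (.endpoint SE) => .joint (.inr true) false
    | .inr (.endpoint NE) => .joint (.inr true) true
  invFun
    | .crossing (.inl c) i => .inl (.crossing c i)
    | .crossing (.inr c) i => .inr (.crossing c i)
    | .joint (.inl (.inl j)) b => .inl (.joint j b)
    | .joint (.inl (.inr j)) b => .inr (.joint j b)
    | .endpoint NW => .inl (.endpoint NW)
    | .endpoint NE => .inl (.endpoint NE)
    | .endpoint SW => .inr (.endpoint SW)
    | .endpoint SE => .inr (.endpoint SE)
    | .joint (.inr false) false => .inl (.endpoint SW)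
    | .joint (.inr false) true => .inr (.endpoint NW)
    | .joint (.inr true) false => .inl (.endpoint SE)
    | .joint (.inr true) true => .inr (.endpoint NE)
  left_inv := by rintro ((_ | _ | (_ | _ | _ | _)) | (_ | _ | (_ | _ | _ | _))) <;> rfl
  right_inv := by
    rintro (⟨_ | _, _⟩ | ⟨(_ | _) | (_ | _), (_ | _)⟩ | (_ | _ | _ | _)) <;> rfl

/-- The sum `T + S` of tangle diagrams, `T` on the left. -/
def add (T S : TangleDiagram) : TangleDiagram where
  Crossing := T.Crossing ⊕ S.Crossing
  Joint := (T.Joint ⊕ S.Joint) ⊕ Bool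
  edge d := addEquiv _ _ _ _ (Sum.map T.edge S.edge ((addEquiv _ _ _ _).symm d))
  edge_edge d := by
    rw [Equiv.symm_apply_apply, ← Equiv.eq_symm_apply]
    rcases (addEquiv T.Crossing T.Joint S.Crossing S.Joint).symm d with x | x <;>
      simp [T.edge_edge, S.edge_edge]
  edge_ne d h := by
    rw [← Equiv.eq_symm_apply] at h
    cases hd : (addEquiv T.Crossing T.Joint S.Crossing S.Joint).symm d with
    | inl x => rw [hd] at h; exact T.edge_ne x (Sum.inl_injective h)
    | inr x => rw [hd] at h; exact S.edge_ne x (Sum.inr_injective h)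
  oddOver := Sum.elim T.oddOver S.oddOver

/-- The product `T * S` of tangle diagrams, `T` above `S`. -/
def mul (T S : TangleDiagram) : TangleDiagram where
  Crossing := T.Crossing ⊕ S.Crossing
  Joint := (T.Joint ⊕ S.Joint) ⊕ Bool
  edge d := mulEquiv _ _ _ _ (Sum.map T.edge S.edge ((mulEquiv _ _ _ _).symm d))
  edge_edge d := by
    rw [Equiv.symm_apply_apply, ← Equiv.eq_symm_apply]
    rcases (mulEquiv T.Crossing T.Joint S.Crossing S.Joint).symm d with x | x <;>
      simp [T.edge_edge, S.edge_edge]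
  edge_ne d h := by
    rw [← Equiv.eq_symm_apply] at h
    cases hd : (mulEquiv T.Crossing T.Joint S.Crossing S.Joint).symm d with
    | inl x => rw [hd] at h; exact T.edge_ne x (Sum.inl_injective h)
    | inr x => rw [hd] at h; exact S.edge_ne x (Sum.inr_injective h)
  oddOver := Sum.elim T.oddOver S.oddOver

/-- The tangle `0`: two horizontal arcs. -/
def zero : TangleDiagram where
  Crossing := Empty
  Joint := Empty
  edge
    | .endpoint NW => .endpoint NE
    | .endpoint NE => .endpoint NW
    | .endpoint SW => .endpoint SE
    | .endpoint SE => .endpoint SW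
  edge_edge := by rintro (⟨⟨⟩⟩ | ⟨⟨⟩⟩ | (_ | _ | _ | _)) <;> rfl
  edge_ne := by rintro (⟨⟨⟩⟩ | ⟨⟨⟩⟩ | (_ | _ | _ | _)) <;> simp
  oddOver := Empty.elim

/-- The tangle `∞`: two vertical arcs. -/
def infty : TangleDiagram where
  Crossing := Empty
  Joint := Empty
  edge
    | .endpoint NW => .endpoint SW
    | .endpoint SW => .endpoint NW
    | .endpoint NE => .endpoint SE
    | .endpoint SE => .endpoint NE
  edge_edge := by rintro (⟨⟨⟩⟩ | ⟨⟨⟩⟩ | (_ | _ | _ | _)) <;> rfl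
  edge_ne := by rintro (⟨⟨⟩⟩ | ⟨⟨⟩⟩ | (_ | _ | _ | _)) <;> simp
  oddOver := Empty.elim

/-- The endpoint to which the end `i` of the only crossing of the tangles `±1` is connected. -/
def cornerOf : ZMod 4 → Endpoint := fun i => ![NW, SW, SE, NE] i

/-- The end of the only crossing of the tangles `±1` that is connected to a given endpoint. -/
def endAt : Endpoint → ZMod 4
  | NW => 0
  | SW => 1
  | SE => 2
  | NE => 3

/-- The tangle `1` (for `ε = true`; the overstrand runs from SW to NE, with positive slope) and
the tangle `-1` (for `ε = false`; the overstrand runs from NW to SE). -/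
def unit (ε : Bool) : TangleDiagram where
  Crossing := Unit
  Joint := Empty
  edge
    | .crossing _ i => .endpoint (cornerOf i)
    | .endpoint x => .crossing () (endAt x)
  edge_edge := by
    have h : ∀ i, endAt (cornerOf i) = i := by decide
    rintro (⟨⟨⟩, i⟩ | ⟨⟨⟩⟩ | (_ | _ | _ | _)) <;> first | rfl | simp [h]
  edge_ne := by rintro (⟨⟨⟩, i⟩ | ⟨⟨⟩⟩ | (_ | _ | _ | _)) <;> simp
  oddOver _ := ε

/-- The sum of `n` copies of the tangle `±1`. -/
def rowOf (ε : Bool) : ℕ → TangleDiagram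
  | 0 => zero
  | n + 1 => add (rowOf ε n) (unit ε)

/-- The vertical stack of `n` copies of the tangle `±1`. -/
def columnOf (ε : Bool) : ℕ → TangleDiagram
  | 0 => infty
  | n + 1 => mul (columnOf ε n) (unit ε)

/-- The integral tangle `a`: a row of `|a|` crossings of the sign of `a`. -/
def integral (a : ℤ) : TangleDiagram := rowOf (decide (0 ≤ a)) a.natAbs

/-- The vertical tangle `1/a`: a column of `|a|` crossings of the sign of `a`. -/
def vertical (a : ℤ) : TangleDiagram := columnOf (decide (0 ≤ a)) a.natAbs

/-- `rationalAux true as` is the diagram of the continued fraction `[a₁, …, aₙ]`, and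
`rationalAux false as` that of its inverse: `[a₁, a₂, …, aₙ] = 1/[a₂, …, aₙ] + a₁` and
`1/[a₁, a₂, …, aₙ] = [a₂, …, aₙ] * (1/a₁)`. -/
def rationalAux : Bool → List ℤ → TangleDiagram
  | true, [] => infty
  | false, [] => zero
  | true, a :: as => add (rationalAux false as) (integral a)
  | false, a :: as => mul (rationalAux true as) (vertical a)

/-- The rational tangle diagram `[a₁, …, aₙ]`. -/
def rational (as : List ℤ) : TangleDiagram := rationalAux true as

end TangleDiagram

/-- The value of the continued fraction `a₁ + 1 / (a₂ + ⋯ + 1 / aₙ)`. -/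
def cfValue : List ℤ → ℚ
  | [] => 0
  | [a] => a
  | a :: b :: as => a + 1 / cfValue (b :: as)

/-- `as = [a₁, …, aₙ]`, `n ≥ 1`, is a continued fraction of `q` with `a₂, …, aₙ ≠ 0` and all terms
of the same sign, so that `TangleDiagram.rational as` is a standard diagram of the rational
tangle `q`. -/
def IsStandardExpansion (q : ℚ) (as : List ℤ) : Prop :=
  as ≠ [] ∧ (∀ a ∈ as.tail, a ≠ 0) ∧ ((∀ a ∈ as, 0 ≤ a) ∨ (∀ a ∈ as, a ≤ 0)) ∧ cfValue as = q

/-! At `A = exp (π i / 4)` the circle value `-A² - A⁻²` is zero, so only the Kauffman states with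
exactly one circle contribute to the bracket, each by `A` to its weight (the number of smoothings
`A` minus the number of smoothings `B`). In a planar alternating diagram all these states have the
same weight (`numB_eq_of_loops_eq_one`), so the determinant counts them. Indeed, a connected planar
diagram with `n` crossings has `n + 2` faces; if it is alternating, its faces inject into the
circles of the all-`A` and all-`B` states. One change of smoothing alters the number of circles by
at most one, so a one-circle state with `b` smoothings `B` bounds these two numbers by `b + 1` and
`n - b + 1`. The sum of the bounds is `n + 2`, so equality holds and `b` is determined. Alternation
enters only through a two-colouring of the edge ends (`IsColoring`).

For (1), let `k` be the common weight of the one-circle states of the alternating diagram obtained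
by the crossing change, which exchanges the two smoothings at `c`. Then the one-circle states of the
two smoothed diagrams have weights `k + 1` and `k - 1`. In `⟨D⟩ = A ⟨D₀⟩ + A⁻¹ ⟨D_∞⟩` the terms
acquire the phases `A ^ (k + 2)` and `A ^ (k - 2)`, which are opposite because `A⁴ = -1`.

For (2), call a tangle tame if no state has one circle in both closures. For tame tangles the
brackets satisfy `n(R + S) = d(R) n(S) + n(R) d(S)` and `d(R + S) = d(R) d(S)`, and the same with
the roles exchanged for vertical products. Hence a rational tangle `p / q` has numerator and
denominator brackets `i p u` and `q u` with `|u| = 1` (`hasFraction_rational`). For an alternating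
`T` of type 1 the two brackets are likewise `i v` and `v` times their absolute values
(`exists_phase`), so the bracket of `n(R + T)` is `i u v (q det n(T) + p det d(T))`.

The phase of `T` comes from the same rigidity of weights: the complementary disk is shrunk to an
extra crossing, whose two smoothings are the two closures. Face counting shows that the colours of
the endpoints alternate (`boundary_alternates`), so the new diagram is again coloured, and the
one-circle states of the two closures have weights differing by 2, with a sign fixed by the type.
This also gives tameness (`isTame_of_isAlternating`). -/

/-! ### Counting orbits -/

section Orbits

variable {α β : Type}

/-- The class of an element in the quotient counted by `numOrbits`. -/
abbrev orbitMk (S : Set (α → α)) (x : α) : Quot fun x y : α => ∃ f ∈ S, f x = y := Quot.mk _ x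

theorem orbitMk_apply {S : Set (α → α)} {f : α → α} (hf : f ∈ S) (x : α) :
    orbitMk S (f x) = orbitMk S x :=
  (Quot.sound ⟨f, hf, rfl⟩).symm

theorem numOrbits_congr (e : α ≃ β) {S : Set (α → α)} {S' : Set (β → β)}
    (h : ∀ f ∈ S, ∃ f' ∈ S', ∀ x, e (f x) = f' (e x))
    (h' : ∀ f' ∈ S', ∃ f ∈ S, ∀ x, e (f x) = f' (e x)) : numOrbits S = numOrbits S' := by
  refine Nat.card_congr (Quot.congr e fun a b => ⟨?_, ?_⟩)
  · rintro ⟨f, hf, rfl⟩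
    obtain ⟨f', hf', hx⟩ := h f hf
    exact ⟨f', hf', (hx a).symm⟩
  · rintro ⟨f', hf', hab⟩
    obtain ⟨f, hf, hx⟩ := h' f' hf'
    exact ⟨f, hf, e.injective ((hx a).trans hab)⟩

theorem numOrbits_congr_singleton (e : α ≃ β) {f : α → α} {f' : β → β}
    (h : ∀ x, e (f x) = f' (e x)) : numOrbits {f} = numOrbits {f'} :=
  numOrbits_congr e (by simpa using h) (by simpa using h)

theorem numOrbits_congr_pair (e : α ≃ β) {f g : α → α} {f' g' : β → β}
    (hf : ∀ x, e (f x) = f' (e x)) (hg : ∀ x, e (g x) = g' (e x)) :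
    numOrbits {f, g} = numOrbits {f', g'} := by
  apply numOrbits_congr e
  · rintro _ (rfl | rfl)
    exacts [⟨f', by simp, hf⟩, ⟨g', by simp, hg⟩]
  · rintro _ (rfl | rfl)
    exacts [⟨f, by simp, hf⟩, ⟨g, by simp, hg⟩]

/-- Connectedness tested by two-valued invariant functions; the indicator of one class is the
decisive test. All later arguments about single circles use this form, because such functions
restrict and glue well. -/
theorem numOrbits_eq_one_iff [Nonempty α] (S : Set (α → α)) :
    numOrbits S = 1 ↔
      ∀ g : α → Bool, (∀ f ∈ S, ∀ x, g (f x) = g x) → ∀ x y, g x = g y := by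
  classical
  unfold numOrbits
  rw [Nat.card_eq_one_iff_unique]
  constructor
  · rintro ⟨h, -⟩ g hg x y
    have := congrArg (Quot.lift g (by rintro a _ ⟨f, hf, rfl⟩; exact (hg f hf a).symm))
      (h.elim (orbitMk S x) (orbitMk S y))
    exact this
  · intro h
    refine ⟨⟨?_⟩, ⟨orbitMk S (Classical.arbitrary α)⟩⟩
    rintro ⟨x⟩ ⟨y⟩
    have := h (fun z => decide (orbitMk S z = orbitMk S x))
      (fun f hf z => by simp only [orbitMk_apply hf]) y x
    simpa [eq_comm] using this

theorem numOrbits_pair_eq_one_iff [Nonempty α] (p q : α → α) :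
    numOrbits {p, q} = 1 ↔
      ∀ g : α → Bool, (∀ x, g (p x) = g x) → (∀ x, g (q x) = g x) → ∀ x y, g x = g y := by
  simp [numOrbits_eq_one_iff]

theorem numOrbits_pair_eq_one_iff_of_equiv [Nonempty α] (e : α ≃ β) (p q : β → β) :
    numOrbits {p, q} = 1 ↔ ∀ g : α → Bool, (∀ x, g (e.symm (p (e x))) = g x) →
      (∀ x, g (e.symm (q (e x))) = g x) → ∀ x y, g x = g y := by
  rw [← numOrbits_pair_eq_one_iff (fun x => e.symm (p (e x))) fun x => e.symm (q (e x)),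
    numOrbits_congr_pair e (fun x => e.apply_symm_apply _) fun x => e.apply_symm_apply _]

theorem numOrbits_pos [Finite α] [Nonempty α] (S : Set (α → α)) : 0 < numOrbits S :=
  Nat.card_pos_iff.mpr ⟨⟨orbitMk S (Classical.arbitrary α)⟩, inferInstance⟩

/-- The functions in `S'` preserve the classes of `S` up to identification of the classes of `a`
and `b`. -/
def PreservesUpTo (S S' : Set (α → α)) (a b : α) : Prop :=
  ∀ f ∈ S', ∀ x, orbitMk S (f x) = orbitMk S x ∨
    ((orbitMk S x = orbitMk S a ∨ orbitMk S x = orbitMk S b) ∧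
      (orbitMk S (f x) = orbitMk S a ∨ orbitMk S (f x) = orbitMk S b))

/-- Collapsing the class of `b` onto that of `a` makes the class of a point invariant under `S'`. -/
theorem PreservesUpTo.exists_map {S S' : Set (α → α)} {a b : α} (h : PreservesUpTo S S' a b) :
    ∃ m : (Quot fun x y : α => ∃ f ∈ S', f x = y) → Quot fun x y : α => ∃ f ∈ S, f x = y,
      (∀ x, orbitMk S x ≠ orbitMk S b → m (orbitMk S' x) = orbitMk S x) ∧
        m (orbitMk S' a) = orbitMk S a ∧ m (orbitMk S' b) = orbitMk S a := by
  classical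
  refine ⟨Quot.lift (fun x => if orbitMk S x = orbitMk S b then orbitMk S a else orbitMk S x) ?_,
    fun x hx => if_neg hx, ?_, if_pos rfl⟩
  · rintro x _ ⟨f, hf, rfl⟩
    have := h f hf x
    split_ifs <;> grind
  · change (if _ then _ else _) = _
    split_ifs <;> rfl

theorem PreservesUpTo.numOrbits_le_add_one [Finite α] {S S' : Set (α → α)} {a b : α}
    (h : PreservesUpTo S S' a b) : numOrbits S ≤ numOrbits S' + 1 := by
  classical
  obtain ⟨m, hm, -, -⟩ := h.exists_map
  have hs : Function.Surjective (fun o : Option _ => o.elim (orbitMk S b) m) := by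
    rintro ⟨x⟩
    by_cases hx : orbitMk S x = orbitMk S b
    · exact ⟨none, hx.symm⟩
    · exact ⟨some (orbitMk S' x), hm x hx⟩
  have := Nat.card_le_card_of_surjective _ hs
  rwa [Finite.card_option] at this

/-- The collapsing map hits the class of `a` twice, from the distinct `S'`-classes of `a` and `b`,
so the second of these can be redirected to the missed class of `b`. -/
theorem PreservesUpTo.numOrbits_le [Finite α] {S S' : Set (α → α)} {a b : α}
    (h : PreservesUpTo S S' a b) (hab : orbitMk S' a ≠ orbitMk S' b) :
    numOrbits S ≤ numOrbits S' := by
  classical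
  obtain ⟨m, hm, ha, hb⟩ := h.exists_map
  have hs : Function.Surjective (fun q => if q = orbitMk S' b then orbitMk S b else m q) := by
    rintro ⟨x⟩
    by_cases hx : orbitMk S x = orbitMk S b
    · exact ⟨orbitMk S' b, by simpa using hx.symm⟩
    · by_cases hx' : orbitMk S' x = orbitMk S' b
      · refine ⟨orbitMk S' a, (if_neg hab).trans ?_⟩
        rw [ha, ← hb, ← hx']
        exact hm x hx
      · exact ⟨orbitMk S' x, (if_neg hx').trans (hm x hx)⟩
  exact Nat.card_le_card_of_surjective _ hs

theorem two_mul_numOrbits_of_involutive [Finite α] {f : α → α} (hf : ∀ x, f (f x) = x)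
    (hne : ∀ x, f x ≠ x) : 2 * numOrbits {f} = Nat.card α := by
  classical
  have := Fintype.ofFinite α
  let r : α → α → Prop := fun x y => ∃ g ∈ ({f} : Set (α → α)), g x = y
  have key : ∀ x y, orbitMk {f} y = orbitMk {f} x ↔ y = x ∨ y = f x := by
    refine fun x y => ⟨fun h => ?_, ?_⟩
    · have := congrArg (Quot.lift (fun z => decide (z = x ∨ z = f x)) (by
        rintro a b ⟨g, hg, hb⟩
        rw [Set.mem_singleton_iff.mp hg] at hb
        subst hb
        have h1 : f a = x ↔ a = f x := ⟨fun h => by rw [← h, hf], fun h => by rw [h, hf]⟩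
        have h2 : f a = f x ↔ a = x :=
          ⟨fun h => by rw [← hf a, h, hf], fun h => by rw [h]⟩
        simp only [h1, h2, or_comm])) h
      simpa using this
    · rintro (rfl | rfl)
      · rfl
      · exact orbitMk_apply (Set.mem_singleton f) x
  have := Fintype.ofFinite (Quot r)
  have hc := Finset.card_eq_sum_card_fiberwise (s := Finset.univ) (t := Finset.univ)
    (f := fun x : α => orbitMk {f} x) (by simp)
  have h2 : ∀ q : Quot r, (Finset.univ.filter fun x : α => orbitMk {f} x = q).card = 2 := by
    rintro ⟨x⟩
    have : (Finset.univ.filter fun y : α => orbitMk {f} y = orbitMk {f} x) = {x, f x} := by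
      ext y; simp [key]
    exact (congrArg _ this).trans (Finset.card_pair (hne x).symm)
  rw [Finset.sum_congr rfl fun q _ => h2 q] at hc
  rw [Nat.card_eq_fintype_card, ← Finset.card_univ, hc, numOrbits, Nat.card_eq_fintype_card]
  simp [mul_comm, r]

end Orbits

/-! ### States and colourings of diagrams -/

/-- The darts sorted by the kind of their vertex. -/
def dartEquiv (C J E : Type) : Dart C J E ≃ (C × ZMod 4) ⊕ (J × Bool) ⊕ E where
  toFun
    | .crossing c i => .inl (c, i)
    | .joint j b => .inr (.inl (j, b))
    | .endpoint x => .inr (.inr x)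
  invFun
    | .inl (c, i) => .crossing c i
    | .inr (.inl (j, b)) => .joint j b
    | .inr (.inr x) => .endpoint x
  left_inv := by rintro (_ | _ | _) <;> rfl
  right_inv := by rintro (_ | _ | _) <;> rfl

instance (C J E : Type) [Finite C] [Finite J] [Finite E] : Finite (Dart C J E) :=
  Finite.of_equiv _ (dartEquiv C J E).symm

instance : Fintype Endpoint where
  elems := {.NW, .NE, .SE, .SW}
  complete := by rintro (_ | _ | _ | _) <;> simp

namespace Diagram

variable {E : Type}

/-- The map that sends an end of an edge to the one to which it is connected in the state `s`; the
endpoints are fixed. -/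
def resolve (D : Diagram E) (s : D.Crossing → Bool) :
    Dart D.Crossing D.Joint E → Dart D.Crossing D.Joint E
  | .crossing c i => .crossing c (partner (s c == D.oddOver c) i)
  | .joint j b => .joint j (!b)
  | .endpoint x => .endpoint x

theorem partner_partner : ∀ (b : Bool) (i : ZMod 4), partner b (partner b i) = i := by decide

theorem resolve_resolve (D : Diagram E) (s : D.Crossing → Bool)
    (d : Dart D.Crossing D.Joint E) : D.resolve s (D.resolve s d) = d := by
  rcases d with ⟨c, i⟩ | ⟨j, b⟩ | x <;> simp [resolve, partner_partner]

/-- A two-colouring of the ends of the edges that changes along edges and across joints and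
distinguishes the overstrands at the crossings. -/
structure IsColoring (D : Diagram E) (κ : Dart D.Crossing D.Joint E → Bool) : Prop where
  edge : ∀ d, κ (D.edge d) = !κ d
  joint : ∀ j b, κ (.joint j (!b)) = !κ (.joint j b)
  crossing : ∀ c i, κ (.crossing c i) = (decide (Odd i.val) == D.oddOver c)

namespace IsColoring

variable {D : Diagram E} {κ : Dart D.Crossing D.Joint E → Bool}

/-- Either smoothing joins neighbouring ends of the crossing, one of which is over and the other
under. -/
theorem resolve_crossing (h : D.IsColoring κ) (s : D.Crossing → Bool) (c : D.Crossing)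
    (i : ZMod 4) : κ (D.resolve s (.crossing c i)) = !κ (.crossing c i) := by
  have : ∀ (b o : Bool) (i : ZMod 4),
      (decide (Odd (partner b i).val) == o) = !(decide (Odd i.val) == o) := by decide
  simp only [resolve, h.crossing, this]

theorem leads (h : D.IsColoring κ) {d d' : Dart D.Crossing D.Joint E} (hd : D.Leads d d') :
    κ d' = !κ d := by
  induction hd with
  | edge => exact h.edge d
  | through j b _ ih => rw [h.edge, h.joint, ih, Bool.not_not]

end IsColoring

end Diagram

/-! ### Faces, extreme states and the rigidity of one-circle states -/

namespace LinkDiagram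

theorem loops_eq (D : LinkDiagram) (s : D.Crossing → Bool) :
    D.loops s = numOrbits {Diagram.resolve D s, D.edge} := by
  have : D.statePartner s = Diagram.resolve D s := by
    funext d
    rcases d with _ | _ | _ <;> rfl
  rw [loops, this]

variable {D : LinkDiagram} {κ : Dart D.Crossing D.Joint Empty → Bool}

/-- The faces of a coloured link diagram are circles of the two extreme states. -/
theorem numOrbits_face_le (h : Diagram.IsColoring D κ) :
    numOrbits {D.rot id ∘ D.edge} ≤ D.loops (fun _ => true) + D.loops fun _ => false := by
  -- From an under-end the smoothing `A` turns counterclockwise, from an over-end clockwise; for `B`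
  -- it is the reverse. Hence on each colour class one extreme state agrees with the rotation.
  have hA : ∀ d, κ d = false → Diagram.resolve D (fun _ => true) d = D.rot id d := by
    have : ∀ (o : Bool) (i : ZMod 4), (decide (Odd i.val) == o) = false →
      Diagram.partner (true == o) i = i + 1 := by decide
    rintro (⟨c, i⟩ | ⟨j, b⟩ | ⟨⟨⟩⟩) hd
    · rw [h.crossing] at hd
      simp only [Diagram.resolve, Diagram.rot, this _ _ hd]
    · rfl
  have hA' : ∀ d, κ d = true → D.rot id (Diagram.resolve D (fun _ => true) d) = d := by
    have : ∀ (o : Bool) (i : ZMod 4), (decide (Odd i.val) == o) = true →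
      Diagram.partner (true == o) i + 1 = i := by decide
    rintro (⟨c, i⟩ | ⟨j, b⟩ | ⟨⟨⟩⟩) hd
    · rw [h.crossing] at hd
      simp only [Diagram.resolve, Diagram.rot, this _ _ hd]
    · simp [Diagram.resolve, Diagram.rot]
  have hB : ∀ d, κ d = true → Diagram.resolve D (fun _ => false) d = D.rot id d := by
    have : ∀ (o : Bool) (i : ZMod 4), (decide (Odd i.val) == o) = true →
      Diagram.partner (false == o) i = i + 1 := by decide
    rintro (⟨c, i⟩ | ⟨j, b⟩ | ⟨⟨⟩⟩) hd
    · rw [h.crossing] at hd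
      simp only [Diagram.resolve, Diagram.rot, this _ _ hd]
    · rfl
  have hB' : ∀ d, κ d = false → D.rot id (Diagram.resolve D (fun _ => false) d) = d := by
    have : ∀ (o : Bool) (i : ZMod 4), (decide (Odd i.val) == o) = false →
      Diagram.partner (false == o) i + 1 = i := by decide
    rintro (⟨c, i⟩ | ⟨j, b⟩ | ⟨⟨⟩⟩) hd
    · rw [h.crossing] at hd
      simp only [Diagram.resolve, Diagram.rot, this _ _ hd]
    · simp [Diagram.resolve, Diagram.rot]
  have hres : ∀ s d, κ (Diagram.resolve D s d) = !κ d := by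
    rintro s (⟨c, i⟩ | ⟨j, b⟩ | ⟨⟨⟩⟩)
    exacts [h.resolve_crossing s c i, h.joint j b]
  set φ := D.rot id ∘ D.edge with hφ
  have hmk : ∀ d, orbitMk {φ} (D.rot id (D.edge d)) = orbitMk {φ} d :=
    orbitMk_apply (Set.mem_singleton φ)
  have hrot : ∀ d, κ (D.rot id d) = !κ d := by
    intro d
    cases hd : κ d
    · rw [← hA d hd, hres, hd]
    · rw [← hB d hd, hres, hd]
  -- The face permutation preserves the colour. A face of colour `true` runs along a circle of the
  -- all-`A` state, one of colour `false` along a circle of the all-`B` state.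
  let f : (Quot fun x y => ∃ g ∈ ({φ} : Set _), g x = y) →
      (Quot fun x y => ∃ g ∈ ({Diagram.resolve D (fun _ => true), D.edge} : Set _), g x = y) ⊕
      (Quot fun x y => ∃ g ∈ ({Diagram.resolve D (fun _ => false), D.edge} : Set _), g x = y) :=
    Quot.lift (fun d => if κ d then .inl (orbitMk _ d) else .inr (orbitMk _ d)) (by
      rintro d d' ⟨g, hg, hd'⟩
      rw [Set.mem_singleton_iff.mp hg] at hd'
      have hκ : κ d' = κ d := by rw [← hd', hφ, Function.comp, hrot, h.edge, Bool.not_not]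
      rw [hκ]
      cases hd : κ d
      · simp only [Bool.false_eq_true, if_false]
        rw [← hd', hφ, Function.comp, ← hB _ (by rw [h.edge, hd]; rfl),
          orbitMk_apply (by simp), orbitMk_apply (by simp)]
      · simp only [if_true]
        rw [← hd', hφ, Function.comp, ← hA _ (by rw [h.edge, hd]; rfl),
          orbitMk_apply (by simp), orbitMk_apply (by simp)])
  -- The face is recovered from any dart of its circle: a dart of the wrong colour is first replaced
  -- by the other end of its edge.
  let g₁ : (Quot fun x y => ∃ g ∈ ({Diagram.resolve D (fun _ => true), D.edge} : Set _), g x = y) →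
      Quot fun x y => ∃ g ∈ ({φ} : Set _), g x = y :=
    Quot.lift (fun d => if κ d then orbitMk _ d else orbitMk _ (D.edge d)) (by
      rintro d _ ⟨g, rfl | rfl, rfl⟩
      · rw [hres]
        cases hd : κ d
        · simp only [Bool.false_eq_true, if_false, Bool.not_false, if_true]
          rw [hA d hd, ← hmk (D.edge d), D.edge_edge]
        · simp only [Bool.false_eq_true, if_false, Bool.not_true, if_true]
          rw [← hmk (D.edge _), D.edge_edge, hA' d hd]
      · rw [h.edge]
        cases hd : κ d <;> simp [D.edge_edge])
  let g₂ : (Quot fun x y => ∃ g ∈ ({Diagram.resolve D (fun _ => false), D.edge} : Set _), g x = y) →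
      Quot fun x y => ∃ g ∈ ({φ} : Set _), g x = y :=
    Quot.lift (fun d => if κ d then orbitMk _ (D.edge d) else orbitMk _ d) (by
      rintro d _ ⟨g, rfl | rfl, rfl⟩
      · rw [hres]
        cases hd : κ d
        · simp only [Bool.false_eq_true, if_false, Bool.not_false, if_true]
          rw [← hmk (D.edge _), D.edge_edge, hB' d hd]
        · simp only [Bool.false_eq_true, if_false, Bool.not_true, if_true]
          rw [hB d hd, ← hmk (D.edge d), D.edge_edge]
      · rw [h.edge]
        cases hd : κ d <;> simp [D.edge_edge])
  have hinj : Function.Injective f := by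
    refine Function.LeftInverse.injective (g := Sum.elim g₁ g₂) ?_
    rintro ⟨d⟩
    change Sum.elim g₁ g₂ (if κ d then .inl (orbitMk _ d) else .inr (orbitMk _ d)) = _
    cases hd : κ d
    · simp only [Bool.false_eq_true, if_false, Sum.elim_inr]
      exact if_neg (by simp [hd])
    · simp only [if_true, Sum.elim_inl]
      exact if_pos hd
  rw [loops_eq, loops_eq]
  exact (Nat.card_le_card_of_injective f hinj).trans_eq Nat.card_sum

/-- Changing a state at one crossing changes the number of circles by at most one. -/
theorem loops_le_of_eqOn_compl (D : LinkDiagram) (s s' : D.Crossing → Bool) (c : D.Crossing)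
    (h : ∀ x, x ≠ c → s x = s' x) : D.loops s ≤ D.loops s' + 1 := by
  rw [loops_eq, loops_eq]
  set S : Set (Dart D.Crossing D.Joint Empty → _) := {Diagram.resolve D s, D.edge}
  -- Each arc of either smoothing contains exactly one of the opposite ends `0` and `2`.
  have hc : ∀ i, orbitMk S (.crossing c i) = orbitMk S (.crossing c 0) ∨
      orbitMk S (.crossing c i) = orbitMk S (.crossing c 2) := by
    intro i
    have h1 : orbitMk S (.crossing c (Diagram.partner (s c == D.oddOver c) i)) =
        orbitMk S (.crossing c i) :=
      orbitMk_apply (f := Diagram.resolve D s) (by simp [S]) (.crossing c i)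
    have : ∀ (b : Bool) (i : ZMod 4), (i = 0 ∨ i = 2) ∨ Diagram.partner b i = 0 ∨
      Diagram.partner b i = 2 := by decide
    rcases this (s c == D.oddOver c) i with (h | h) | h | h
    · exact .inl (by rw [h])
    · exact .inr (by rw [h])
    · exact .inl (by rw [← h1, h])
    · exact .inr (by rw [← h1, h])
  refine PreservesUpTo.numOrbits_le_add_one (a := .crossing c 0) (b := .crossing c 2) ?_
  rintro _ (rfl | rfl) x
  · rcases x with ⟨x, i⟩ | ⟨j, b⟩ | ⟨⟨⟩⟩
    · by_cases hx : x = c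
      · subst hx
        exact .inr ⟨hc _, hc _⟩
      · left
        have : Diagram.resolve D s' (.crossing x i) = Diagram.resolve D s (.crossing x i) := by
          simp only [Diagram.resolve, h x hx]
        rw [this, orbitMk_apply (by simp [S])]
    · exact .inl (orbitMk_apply (f := Diagram.resolve D s) (by simp [S]) (.joint j b))
  · exact .inl (orbitMk_apply (by simp [S]) _)

theorem loops_le_add_card (D : LinkDiagram) (s s' : D.Crossing → Bool) (X : Finset D.Crossing)
    (h : ∀ x, x ∉ X → s x = s' x) : D.loops s ≤ D.loops s' + X.card := by
  induction X using Finset.induction_on generalizing s with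
  | empty => rw [funext fun x => h x (by simp)]; simp
  | insert c X hc ih =>
    have h1 := loops_le_of_eqOn_compl D s (Function.update s c (s' c)) c
      fun x hx => by rw [Function.update_of_ne hx]
    have h2 := ih (Function.update s c (s' c)) fun x hx => by
      by_cases hxc : x = c
      · subst hxc; simp
      · rw [Function.update_of_ne hxc]
        exact h x (by simp [hx, hxc])
    rw [Finset.card_insert_of_notMem hc]
    omega

/-- The number of crossings at which the state `s` is the smoothing `B`. -/
def numB (D : LinkDiagram) (s : D.Crossing → Bool) : ℕ :=
  (Finset.univ.filter fun c => s c = false).card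

/-- With `b` smoothings `B` in `s`, the all-`A` state has at most `b + 1` circles and the all-`B`
state at most `n - b + 1`. If the number of faces reaches the sum `n + 2`, both bounds are attained.
-/
theorem numOrbits_face_le_of_loops_eq_one (h : Diagram.IsColoring D κ) {s : D.Crossing → Bool}
    (hs : D.loops s = 1) :
    numOrbits {D.rot id ∘ D.edge} ≤ Fintype.card D.Crossing + 2 ∧
      (numOrbits {D.rot id ∘ D.edge} = Fintype.card D.Crossing + 2 →
        D.numB s + 1 = D.loops fun _ => true) := by
  have h1 := numOrbits_face_le h
  have hA := loops_le_add_card D (fun _ => true) s (Finset.univ.filter fun c => s c = false)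
    (fun x hx => by cases h : s x <;> simp_all)
  have hB := loops_le_add_card D (fun _ => false) s (Finset.univ.filter fun c => ¬ s c = false)
    (fun x hx => by cases h : s x <;> simp_all)
  have h2 := Finset.card_filter_add_card_filter_not (s := Finset.univ) fun c => s c = false
  rw [Finset.card_univ] at h2
  unfold numB
  omega

/-- A diagram with a one-circle state is connected. -/
theorem isConnected_of_loops_eq_one {D : LinkDiagram} {s : D.Crossing → Bool}
    (hs : D.loops s = 1) : Diagram.IsConnected D := by
  have hne : Nonempty (Dart D.Crossing D.Joint Empty) := by
    by_contra hne
    rw [not_nonempty_iff] at hne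
    rw [loops, numOrbits, Nat.card_of_isEmpty] at hs
    omega
  rw [Diagram.IsConnected, numOrbits_pair_eq_one_iff]
  rw [loops_eq, numOrbits_pair_eq_one_iff] at hs
  intro g hg hg'
  refine hs g ?_ hg'
  rintro (⟨c, i⟩ | ⟨j, b⟩ | ⟨⟨⟩⟩)
  · have h1 : ∀ i, g (.crossing c (i + 1)) = g (.crossing c i) := fun i => hg (.crossing c i)
    simp only [Diagram.resolve, Diagram.partner]
    split_ifs
    · exact h1 i
    · rw [← h1, sub_add_cancel]
  · exact hg (.joint j b)

/-- Euler's formula with one component: with `n` crossings and `j` joints there are `n + j` vertices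
and `2n + j` edges. -/
theorem numOrbits_face_eq (hD : D.IsPlanar) {s : D.Crossing → Bool} (hs : D.loops s = 1) :
    numOrbits {D.rot id ∘ D.edge} = Fintype.card D.Crossing + 2 := by
  have hE := two_mul_numOrbits_of_involutive D.edge_edge D.edge_ne
  have hcard : Nat.card (Dart D.Crossing D.Joint Empty) =
      Fintype.card D.Crossing * 4 + Fintype.card D.Joint * 2 := by
    rw [Nat.card_congr (dartEquiv _ _ _), Nat.card_sum, Nat.card_sum, Nat.card_prod, Nat.card_prod]
    simp
  have hV : numOrbits {D.rot id} = Fintype.card D.Crossing + Fintype.card D.Joint := by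
    rw [numOrbits, ← Nat.card_eq_fintype_card, ← Nat.card_eq_fintype_card, ← Nat.card_sum]
    let v : Dart D.Crossing D.Joint Empty → D.Crossing ⊕ D.Joint
      | .crossing c _ => .inl c
      | .joint j _ => .inr j
    refine Nat.card_congr ⟨Quot.lift v ?_, Sum.elim (fun c => orbitMk _ (.crossing c 0))
      fun j => orbitMk _ (.joint j false), ?_, ?_⟩
    · rintro d _ ⟨_, rfl, rfl⟩
      rcases d with ⟨c, i⟩ | ⟨j, b⟩ | ⟨⟨⟩⟩ <;> rfl
    · have hr : ∀ d, orbitMk {D.rot id} (D.rot id d) = orbitMk {D.rot id} d :=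
        orbitMk_apply (Set.mem_singleton (D.rot id))
      rintro ⟨⟨c, i⟩ | ⟨j, b⟩ | ⟨⟨⟩⟩⟩
      · have : ∀ n : ℕ, orbitMk {D.rot id} (.crossing c (n : ZMod 4)) =
            orbitMk {D.rot id} (.crossing c 0) := by
          intro n
          induction n with
          | zero => simp
          | succ n ih =>
            rw [← ih, ← hr (.crossing c (n : ZMod 4))]
            simp [Diagram.rot]
        have h := this i.val
        rw [ZMod.natCast_zmod_val] at h
        exact h.symm
      · cases b
        · rfl
        · exact (hr (.joint j false)).symm
    · rintro (c | j) <;> rfl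
  have hC : numOrbits {D.rot id, D.edge} = 1 := isConnected_of_loops_eq_one hs
  have := hD
  rw [IsPlanar, Diagram.EulerFormula, hV, hC] at this
  omega

/-- The one-circle states of a planar coloured link diagram all have the same number of smoothings
`B`. -/
theorem numB_eq_of_loops_eq_one (hD : D.IsPlanar) (h : Diagram.IsColoring D κ)
    {s t : D.Crossing → Bool} (hs : D.loops s = 1) (ht : D.loops t = 1) : D.numB s = D.numB t := by
  have h1 := (numOrbits_face_le_of_loops_eq_one h hs).2 (numOrbits_face_eq hD hs)
  have h2 := (numOrbits_face_le_of_loops_eq_one h ht).2 (numOrbits_face_eq hD ht)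
  omega

end LinkDiagram

/-! ### Strands and the existence of colourings -/

namespace Diagram

variable {E : Type} {D : Diagram E}

/-- The edge involution and the passage through a joint are injective, so a strand can be traced
backwards, and the first dart that is not a joint is its source. -/
theorem Leads.source_unique {x x' d : Dart D.Crossing D.Joint E}
    (hx : ∀ j b, x ≠ .joint j b) (hx' : ∀ j b, x' ≠ .joint j b)
    (h : D.Leads x d) (h' : D.Leads x' d) : x = x' := by
  have inj : ∀ {a b}, D.edge a = D.edge b → a = b := fun {a b} h => by
    rw [← D.edge_edge a, h, D.edge_edge]
  induction h with
  | edge =>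
    generalize hd : D.edge x = d at h'
    cases h' with
    | edge => exact inj hd
    | through j b => exact absurd (inj hd) (hx _ _)
  | through j b _ ih =>
    generalize hd : D.edge (.joint j (!b)) = d at h'
    cases h' with
    | edge => exact absurd (inj hd).symm (hx' _ _)
    | through j' b' h' =>
      have := inj hd
      simp only [Dart.joint.injEq, Bool.not_inj_iff] at this
      obtain ⟨rfl, rfl⟩ := this
      exact ih h'

/-- The second walk, read backwards from `d`, is appended to the first one. -/
theorem Leads.trans_symm {x x' d d' : Dart D.Crossing D.Joint E}
    (h : D.Leads x d) (h' : D.Leads x' d') (hd : d' = D.edge d) : D.Leads x x' := by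
  induction h' generalizing d with
  | edge =>
    have : x' = d := by rw [← D.edge_edge x', hd, D.edge_edge]
    exact this ▸ h
  | through j b _ ih =>
    have hd' : Dart.joint j (!b) = d := by rw [← D.edge_edge (.joint j _), hd, D.edge_edge]
    subst hd'
    have := h.through
    rw [Bool.not_not] at this
    exact ih this (D.edge_edge _).symm

theorem Leads.symm {x y : Dart D.Crossing D.Joint E} (h : D.Leads x y) : D.Leads y x :=
  Leads.edge.trans_symm h (D.edge_edge y).symm

theorem Leads.edge_of_joint {x : Dart D.Crossing D.Joint E} {j : D.Joint} {b : Bool}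
    (hx : ∀ j b, x ≠ .joint j b) (h : D.Leads x (D.edge (.joint j b))) :
    D.Leads x (.joint j (!b)) := by
  generalize hd : D.edge (.joint j b) = d at h
  have inj : ∀ {a b}, D.edge a = D.edge b → a = b := fun {a b} h => by
    rw [← D.edge_edge a, h, D.edge_edge]
  cases h with
  | edge => exact absurd (inj hd).symm (hx _ _)
  | through j' b' h' =>
    have := inj hd
    simp only [Dart.joint.injEq] at this
    obtain ⟨rfl, rfl⟩ := this
    rwa [Bool.not_not]

/-- The colouring obtained by continuing the labels of the darts in `Y` along the strands. -/
inductive Continues (D : Diagram E) (Y : Set (Dart D.Crossing D.Joint E))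
    (lab : Dart D.Crossing D.Joint E → Bool) : Dart D.Crossing D.Joint E → Bool → Prop
  | source {y} : y ∈ Y → Continues D Y lab y (lab y)
  | edge {d b} : Continues D Y lab d b → Continues D Y lab (D.edge d) (!b)
  | joint {j e b} : Continues D Y lab (.joint j e) b → Continues D Y lab (.joint j (!e)) (!b)

variable {Y : Set (Dart D.Crossing D.Joint E)} {lab : Dart D.Crossing D.Joint E → Bool}

/-- Along the strand from `y`, the darts by which it departs carry the label of `y`, those at which
it arrives the opposite one. -/
theorem Continues.exists_leads (hY : ∀ y ∈ Y, ∀ j b, y ≠ .joint j b)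
    {d : Dart D.Crossing D.Joint E} {b : Bool} (h : D.Continues Y lab d b) :
    ∃ y ∈ Y, (b = lab y ∧ D.Leads y (D.edge d)) ∨ (b = !lab y) ∧ D.Leads y d := by
  induction h with
  | source hy => exact ⟨_, hy, .inl ⟨rfl, .edge⟩⟩
  | edge _ ih =>
    obtain ⟨y, hy, ⟨rfl, h⟩ | ⟨rfl, h⟩⟩ := ih
    · exact ⟨y, hy, .inr ⟨rfl, h⟩⟩
    · exact ⟨y, hy, .inl ⟨Bool.not_not _, by rwa [D.edge_edge]⟩⟩
  | joint _ ih =>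
    obtain ⟨y, hy, ⟨rfl, h⟩ | ⟨rfl, h⟩⟩ := ih
    · exact ⟨y, hy, .inr ⟨rfl, h.edge_of_joint (hY y hy)⟩⟩
    · exact ⟨y, hy, .inl ⟨Bool.not_not _, h.through⟩⟩

theorem Continues.unique (hY : ∀ y ∈ Y, ∀ j b, y ≠ .joint j b)
    (hlab : ∀ y ∈ Y, ∀ y' ∈ Y, D.Leads y y' → lab y' = !lab y)
    {d : Dart D.Crossing D.Joint E} {b b' : Bool} (h : D.Continues Y lab d b)
    (h' : D.Continues Y lab d b') : b = b' := by
  obtain ⟨y, hy, ⟨rfl, hl⟩ | ⟨rfl, hl⟩⟩ := h.exists_leads hY <;>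
    obtain ⟨y', hy', ⟨rfl, hl'⟩ | ⟨rfl, hl'⟩⟩ := h'.exists_leads hY
  · rw [hl.source_unique (hY y hy) (hY y' hy') hl']
  · rw [hlab y' hy' y hy (hl'.trans_symm hl rfl)]
  · rw [hlab y hy y' hy' (hl.trans_symm hl' rfl)]
  · rw [hl.source_unique (hY y hy) (hY y' hy') hl']

/-- The only possible conflict is on a strand whose two ends are both in `Y`, and `hlab` excludes
it. The hypothesis `htot` says, as an induction principle, that every dart is reached from `Y`. -/
theorem exists_coloring_of_labels (hY : ∀ y ∈ Y, ∀ j b, y ≠ .joint j b)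
    (hlab : ∀ y ∈ Y, ∀ y' ∈ Y, D.Leads y y' → lab y' = !lab y)
    (htot : ∀ p : Dart D.Crossing D.Joint E → Prop, (∀ y ∈ Y, p y) → (∀ d, p d → p (D.edge d)) →
      (∀ j b, p (.joint j b) → p (.joint j (!b))) → ∀ d, p d) :
    ∃ κ : Dart D.Crossing D.Joint E → Bool, (∀ d, κ (D.edge d) = !κ d) ∧
      (∀ j b, κ (.joint j (!b)) = !κ (.joint j b)) ∧ ∀ y ∈ Y, κ y = lab y := by
  have h := htot (fun d => ∃ b, D.Continues Y lab d b) (fun y hy => ⟨_, .source hy⟩)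
    (fun d ⟨b, h⟩ => ⟨_, h.edge⟩) fun j e ⟨b, h⟩ => ⟨_, h.joint⟩
  choose κ hκ using h
  have hu := fun {d b b'} => Continues.unique (d := d) (b := b) (b' := b') hY hlab
  exact ⟨κ, fun d => hu (hκ _) (hκ d).edge, fun j b => hu (hκ _) (hκ _).joint,
    fun y hy => hu (hκ y) (.source hy)⟩

/-- The label of a dart that belongs to a crossing: whether it is part of the overstrand. -/
def overLabel (D : Diagram E) : Dart D.Crossing D.Joint E → Bool
  | .crossing c i => decide (Odd i.val) == D.oddOver c
  | _ => true

theorem overLabel_eq_true_iff (c : D.Crossing) (i : ZMod 4) :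
    D.overLabel (.crossing c i) = true ↔ D.IsOver c i := by
  rw [overLabel, IsOver, beq_iff_eq]
  cases D.oddOver c <;> simp

theorem IsAlternating.overLabel_eq (h : D.IsAlternating) {c c' : D.Crossing} {i i' : ZMod 4}
    (hl : D.Leads (.crossing c i) (.crossing c' i')) :
    D.overLabel (.crossing c' i') = !D.overLabel (.crossing c i) := by
  have := h c c' i i' hl
  rw [← overLabel_eq_true_iff, ← overLabel_eq_true_iff] at this
  cases h1 : D.overLabel (.crossing c' i') <;> cases h2 : D.overLabel (.crossing c i) <;> simp_all

/-- A connected alternating diagram with a crossing has a colouring. -/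
theorem IsAlternating.exists_isColoring (h : D.IsAlternating) (hc : D.IsConnected)
    (c : D.Crossing) : ∃ κ, D.IsColoring κ := by
  classical
  obtain ⟨κ, h1, h2, h3⟩ := exists_coloring_of_labels (D := D) (lab := D.overLabel)
    (Y := {d | ∃ c i, d = .crossing c i}) (by rintro _ ⟨c, i, rfl⟩; simp)
    (by rintro _ ⟨c, i, rfl⟩ _ ⟨c', i', rfl⟩ hl; exact h.overLabel_eq hl) (by
      intro p hp he hj d
      have : Nonempty (Dart D.Crossing D.Joint E) := ⟨d⟩
      rw [IsConnected, numOrbits_pair_eq_one_iff] at hc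
      -- Since `p` holds at all ends of all crossings, it is invariant under rotation as well as
      -- under edges, and connectedness spreads it from `c` to every dart.
      have := hc (fun d => decide (p d)) (by
        rintro (⟨c, i⟩ | ⟨j, b⟩ | x)
        · simp only [rot, hp _ ⟨_, _, rfl⟩]
        · have : p (.joint j (!b)) ↔ p (.joint j b) :=
            ⟨fun h => by simpa using hj _ _ h, hj j b⟩
          simp only [rot, this]
        · rfl) (fun d => by
        have : p (D.edge d) ↔ p d := ⟨fun h => by simpa [D.edge_edge] using he _ h, he d⟩
        simp only [this]) d (.crossing c 0)
      have hc0 : p (.crossing c 0) := hp _ ⟨_, _, rfl⟩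
      simpa [hc0] using this)
  exact ⟨κ, h1, h2, fun c i => h3 _ ⟨c, i, rfl⟩⟩

end Diagram

/-! ### The bracket at a primitive eighth root of unity -/

/-- The number of smoothings `A` minus the number of smoothings `B` in a state. -/
def weight {C : Type} [Fintype C] (s : C → Bool) : ℤ := ∑ c, if s c then 1 else -1

/-- The value of `A` for which the bracket gives the determinant. -/
noncomputable def rootA : ℂ := Complex.exp (Real.pi / 4 * Complex.I)

theorem rootA_ne_zero : rootA ≠ 0 := Complex.exp_ne_zero _

theorem norm_rootA : ‖rootA‖ = 1 := by
  rw [rootA, show (Real.pi / 4 * Complex.I : ℂ) = ((Real.pi / 4 : ℝ) : ℂ) * Complex.I by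
    push_cast; rfl, Complex.norm_exp_ofReal_mul_I]

theorem rootA_sq : rootA ^ 2 = Complex.I := by
  have : Complex.exp (Real.pi / 2 * Complex.I) = Complex.I := Complex.exp_pi_div_two_mul_I
  rw [rootA, ← Complex.exp_nat_mul]
  refine Eq.trans (congrArg _ ?_) this
  push_cast
  ring

theorem rootA_inv : rootA⁻¹ = -Complex.I * rootA := by
  rw [inv_eq_iff_eq_inv, eq_comm, inv_eq_iff_eq_inv, eq_comm]
  apply inv_eq_of_mul_eq_one_right
  have := rootA_sq
  linear_combination (-Complex.I) * this - Complex.I_mul_I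

theorem norm_rootA_zpow (k : ℤ) : ‖rootA ^ k‖ = 1 := by
  rw [norm_zpow, norm_rootA, one_zpow]

namespace LinkDiagram

open scoped Classical in
/-- Only the states with one circle contribute to the determinant. -/
theorem bracket_rootA (D : LinkDiagram) [Nonempty (Dart D.Crossing D.Joint Empty)] :
    D.bracket rootA = ∑ s, if D.loops s = 1 then rootA ^ weight s else 0 := by
  refine Finset.sum_congr rfl fun s _ => ?_
  have h0 : -rootA ^ 2 - (rootA⁻¹) ^ 2 = 0 := by
    rw [inv_pow, rootA_sq, Complex.inv_I]
    ring
  -- Nonemptiness matters: for a state without circles the truncated exponent `loops s - 1` would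
  -- also be zero.
  have hpos : 0 < D.loops s := by
    rw [loops_eq]
    exact numOrbits_pos _
  rw [h0]
  split_ifs with h
  · rw [h]
    simp [weight]
  · rw [zero_pow (by omega), mul_zero]

theorem det_eq (D : LinkDiagram) : D.det = ‖D.bracket rootA‖ := rfl

theorem weight_eq_sub_numB (D : LinkDiagram) (s : D.Crossing → Bool) :
    weight s = Fintype.card D.Crossing - 2 * D.numB s := by
  rw [weight, numB, Finset.card_filter, Fintype.card, Finset.card_eq_sum_ones]
  push_cast
  rw [Finset.mul_sum, ← Finset.sum_sub_distrib]
  refine Finset.sum_congr rfl fun c _ => ?_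
  cases s c <;> simp

/-- If all states with one circle have the same weight, then the bracket counts them. -/
theorem bracket_rootA_of_weight_eq (D : LinkDiagram) [Nonempty (Dart D.Crossing D.Joint Empty)]
    {k : ℤ} (h : ∀ s, D.loops s = 1 → weight s = k) :
    ∃ N : ℕ, D.bracket rootA = N * rootA ^ k := by
  classical
  refine ⟨(Finset.univ.filter fun s => D.loops s = 1).card, ?_⟩
  rw [bracket_rootA, ← Finset.sum_filter, ← nsmul_eq_mul]
  exact Finset.sum_eq_card_nsmul fun s hs => by rw [h s (Finset.mem_filter.mp hs).2]

/-- The one-circle states of a planar coloured link diagram all have the same weight. -/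
theorem weight_eq_of_isColoring {D : LinkDiagram} (hD : D.IsPlanar)
    {κ : Dart D.Crossing D.Joint Empty → Bool} (h : Diagram.IsColoring D κ)
    {s t : D.Crossing → Bool} (hs : D.loops s = 1) (ht : D.loops t = 1) : weight s = weight t := by
  rw [weight_eq_sub_numB D, weight_eq_sub_numB D, numB_eq_of_loops_eq_one hD h hs ht]

/-! ### Smoothing one crossing; almost alternating diagrams -/

section Smoothing

variable (D : LinkDiagram) (c : D.Crossing)

/-- The state of `D` with the smoothing `x` at `c` and the smoothings `s` at the other crossings. -/
def extendState (x : Bool) (s : {y : D.Crossing // y ≠ c} → Bool) : D.Crossing → Bool :=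
  (Equiv.funSplitAt c Bool).symm (x, s)

theorem extendState_self (x : Bool) (s : {y : D.Crossing // y ≠ c} → Bool) :
    D.extendState c x s c = x := by
  simp [extendState, Equiv.funSplitAt]

theorem extendState_of_ne (x : Bool) (s : {y : D.Crossing // y ≠ c} → Bool) {y : D.Crossing}
    (hy : y ≠ c) : D.extendState c x s y = s ⟨y, hy⟩ := by
  simp [extendState, Equiv.funSplitAt, hy]

theorem weight_extendState (x : Bool) (s : {y : D.Crossing // y ≠ c} → Bool) :
    weight (D.extendState c x s) = (if x then 1 else -1) + weight s := by
  rw [weight, Fintype.sum_eq_add_sum_subtype_ne _ c, extendState_self, weight]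
  congr 1
  exact Finset.sum_congr rfl fun y _ => by rw [extendState_of_ne _ _ _ _ y.2]

/-- The labels `smoothEnd` are chosen so that `partner` exchanges the two ends of a joint. The value
at `c` is `b == D.oddOver c` because comparing it once more with `D.oddOver c` gives back `b`. -/
theorem loops_smooth (b : Bool) (s : {y : D.Crossing // y ≠ c} → Bool) :
    LinkDiagram.loops (D.smooth c b) s = D.loops (D.extendState c (b == D.oddOver c) s) := by
  have hb : ∀ b i, Diagram.smoothEnd b (Diagram.partner b i) =
    ((Diagram.smoothEnd b i).1, !(Diagram.smoothEnd b i).2) := by decide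
  refine (loops_eq _ _).trans (.trans (.symm ?_) (loops_eq _ _).symm)
  refine numOrbits_congr_pair (D.smoothEquiv c b) ?_ ?_
  · rintro (⟨x, i⟩ | ⟨j, e⟩ | ⟨⟨⟩⟩)
    · by_cases hx : x = c
      · subst hx
        have h1 : ((b == D.oddOver x) == D.oddOver x) = b := by
          cases b <;> cases D.oddOver x <;> rfl
        simp [Diagram.resolve, extendState_self, Diagram.smoothEquiv, h1, hb]
        rfl
      · simp [Diagram.resolve, Diagram.smoothEquiv, hx, extendState_of_ne, Diagram.smooth]
    · simp [Diagram.resolve, Diagram.smoothEquiv]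
      rfl
  · intro d
    simp [Diagram.smooth]

theorem loops_smoothZero (s : {y : D.Crossing // y ≠ c} → Bool) :
    LinkDiagram.loops (D.smoothZero c) s = D.loops (D.extendState c true s) := by
  have := D.loops_smooth c (D.oddOver c) s
  rwa [beq_self_eq_true] at this

theorem loops_smoothInfty (s : {y : D.Crossing // y ≠ c} → Bool) :
    LinkDiagram.loops (D.smoothInfty c) s = D.loops (D.extendState c false s) := by
  have := D.loops_smooth c (!D.oddOver c) s
  have h : ((!D.oddOver c) == D.oddOver c) = false := by cases D.oddOver c <;> rfl
  rwa [h] at this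

/-- Exchanging over and under at `c` exchanges which planar smoothing is called `A` and which `B`.
-/
theorem loops_crossingChange (x : Bool) (s : {y : D.Crossing // y ≠ c} → Bool) :
    LinkDiagram.loops (D.crossingChange c) (D.extendState c x s) =
      D.loops (D.extendState c (!x) s) := by
  refine (loops_eq _ _).trans (.trans ?_ (loops_eq _ _).symm)
  have key : ∀ y : D.Crossing,
      (D.extendState c x s y == Function.update D.oddOver c (!D.oddOver c) y) =
        (D.extendState c (!x) s y == D.oddOver y) := by
    intro y
    obtain rfl | hy := eq_or_ne y c
    · rw [extendState_self, extendState_self, Function.update_self]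
      cases x <;> cases D.oddOver y <;> rfl
    · rw [extendState_of_ne _ _ _ _ hy, extendState_of_ne _ _ _ _ hy, Function.update_of_ne hy]
  refine numOrbits_congr_pair (Equiv.refl _) ?_ fun _ => rfl
  rintro (⟨y, i⟩ | ⟨j, e⟩ | ⟨⟨⟩⟩)
  · exact congrArg (fun b => Dart.crossing y (Diagram.partner b i)) (key y)
  · rfl

theorem isPlanar_crossingChange (hD : D.IsPlanar) :
    LinkDiagram.IsPlanar (D.crossingChange c) := by
  have h : Diagram.rot (D.crossingChange c) id = D.rot id := by
    funext d
    cases d <;> rfl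
  unfold IsPlanar Diagram.EulerFormula at hD ⊢
  rw [h]
  exact hD

open scoped Classical in
theorem bracket_smoothZero : LinkDiagram.bracket (D.smoothZero c) rootA =
    ∑ s : {y : D.Crossing // y ≠ c} → Bool,
      if D.loops (D.extendState c true s) = 1 then rootA ^ weight s else 0 :=
  have : Nonempty (Dart (D.smoothZero c).Crossing (D.smoothZero c).Joint Empty) :=
    ⟨.joint (.inr true) true⟩
  (bracket_rootA _).trans <| Finset.sum_congr rfl fun s _ =>
    if_congr (Iff.of_eq (congrArg (· = 1) (D.loops_smoothZero c s))) rfl rfl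

open scoped Classical in
theorem bracket_smoothInfty : LinkDiagram.bracket (D.smoothInfty c) rootA =
    ∑ s : {y : D.Crossing // y ≠ c} → Bool,
      if D.loops (D.extendState c false s) = 1 then rootA ^ weight s else 0 :=
  have : Nonempty (Dart (D.smoothInfty c).Crossing (D.smoothInfty c).Joint Empty) :=
    ⟨.joint (.inr true) true⟩
  (bracket_rootA _).trans <| Finset.sum_congr rfl fun s _ =>
    if_congr (Iff.of_eq (congrArg (· = 1) (D.loops_smoothInfty c s))) rfl rfl

theorem bracket_smooth :
    D.bracket rootA = rootA * LinkDiagram.bracket (D.smoothZero c) rootA +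
      rootA⁻¹ * LinkDiagram.bracket (D.smoothInfty c) rootA := by
  classical
  have : Nonempty (Dart D.Crossing D.Joint Empty) := ⟨.crossing c 0⟩
  rw [bracket_rootA, bracket_smoothZero, bracket_smoothInfty,
    ← (Equiv.funSplitAt c Bool).symm.sum_comp,
    Fintype.sum_prod_type, Fintype.sum_bool, Finset.mul_sum, Finset.mul_sum]
  congr 1
  · refine Finset.sum_congr rfl fun s _ => ?_
    change (if D.loops (D.extendState c true s) = 1 then
      rootA ^ weight (D.extendState c true s) else 0) = _
    rw [weight_extendState, if_pos rfl, zpow_add₀ rootA_ne_zero, zpow_one, mul_ite, mul_zero]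
  · refine Finset.sum_congr rfl fun s _ => ?_
    change (if D.loops (D.extendState c false s) = 1 then
      rootA ^ weight (D.extendState c false s) else 0) = _
    rw [weight_extendState, if_neg Bool.false_ne_true, zpow_add₀ rootA_ne_zero, zpow_neg_one,
      mul_ite, mul_zero]

theorem det_of_isDealternator (hD : D.IsPlanar) (hc : D.IsDealternator c) :
    D.det = |LinkDiagram.det (D.smoothZero c) - LinkDiagram.det (D.smoothInfty c)| := by
  have h0 : Nonempty (Dart (D.smoothZero c).Crossing (D.smoothZero c).Joint Empty) :=
    ⟨.joint (.inr true) true⟩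
  have h1 : Nonempty (Dart (D.smoothInfty c).Crossing (D.smoothInfty c).Joint Empty) :=
    ⟨.joint (.inr true) true⟩
  have h2 : Nonempty (Dart (D.crossingChange c).Crossing (D.crossingChange c).Joint Empty) :=
    ⟨.crossing c 0⟩
  obtain ⟨k, hk⟩ : ∃ k, ∀ s, LinkDiagram.loops (D.crossingChange c) s = 1 → weight s = k := by
    by_cases hex : ∃ s, LinkDiagram.loops (D.crossingChange c) s = 1
    · obtain ⟨s, hs⟩ := hex
      obtain ⟨κ, hκ⟩ := Diagram.IsAlternating.exists_isColoring hc
        (isConnected_of_loops_eq_one hs) c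
      exact ⟨weight s, fun t ht => weight_eq_of_isColoring (D := D.crossingChange c)
        (D.isPlanar_crossingChange c hD) hκ ht hs⟩
    -- Without one-circle states every `k` is a common weight.
    · exact ⟨0, fun s hs => absurd ⟨s, hs⟩ hex⟩
  -- A state of `D^c_0` uses the smoothing `A` of `D` at `c`, which is the smoothing `B` of the
  -- alternating diagram; this `B` contributes `-1` to `k`.
  obtain ⟨N₀, hN₀⟩ := bracket_rootA_of_weight_eq (D.smoothZero c) (k := k + 1) (by
    intro s hs
    have hs := (D.loops_smoothZero c s).symm.trans hs
    have := hk _ ((D.loops_crossingChange c false s).trans hs)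
    have h := D.weight_extendState c false s
    rw [if_neg (by simp)] at h
    exact (eq_neg_add_iff_add_eq.mp (this.symm.trans h)).symm.trans (add_comm _ _))
  obtain ⟨N₁, hN₁⟩ := bracket_rootA_of_weight_eq (D.smoothInfty c) (k := k - 1) (by
    intro s hs
    have hs := (D.loops_smoothInfty c s).symm.trans hs
    have := hk _ ((D.loops_crossingChange c true s).trans hs)
    have h := D.weight_extendState c true s
    rw [if_pos rfl] at h
    exact eq_sub_of_add_eq ((add_comm _ _).trans (h.symm.trans this)))
  -- The phases are `A * A ^ (k + 1) = i A ^ k` and `A⁻¹ * A ^ (k - 1) = -i A ^ k`.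
  have hb : D.bracket rootA = ((N₀ : ℝ) - N₁ : ℝ) * (Complex.I * rootA ^ k) := by
    rw [bracket_smooth D c, hN₀, hN₁, zpow_add₀ rootA_ne_zero, zpow_sub₀ rootA_ne_zero, zpow_one,
      div_eq_mul_inv, rootA_inv]
    push_cast
    linear_combination (N₀ * rootA ^ k + N₁ * rootA ^ k * Complex.I ^ 2) * rootA_sq +
      (N₁ * rootA ^ k * Complex.I) * Complex.I_sq
  rw [det_eq, det_eq, det_eq, hb, hN₀, hN₁]
  simp only [norm_mul, norm_rootA_zpow, Complex.norm_real, Complex.norm_I, Complex.norm_natCast,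
    mul_one, Real.norm_eq_abs]

end Smoothing

end LinkDiagram

/-! ### Gluing closures by functions with values in the field of two elements -/

section Gluing

variable {α β : Type}

/-- A set of functions which is an algebra of functions with values in the field of two elements,
and for which the values at the four points `a, b, c, d` always have sum zero. -/
structure IsBoundaryAlgebra (I : Set (α → Bool)) (a b c d : α) : Prop where
  const_mem : ∀ v, (fun _ => v) ∈ I
  xor_mem : ∀ g ∈ I, ∀ h ∈ I, (fun x => g x ^^ h x) ∈ I
  and_mem : ∀ g ∈ I, ∀ h ∈ I, (fun x => g x && h x) ∈ I
  parity : ∀ g ∈ I, (g a ^^ g b ^^ g c ^^ g d) = false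

/-- Only constant functions in `I` satisfy `g a = g b` and `g c = g d`. -/
def ClosesUp (I : Set (α → Bool)) (a b c d : α) : Prop :=
  ∀ g ∈ I, g a = g b → g c = g d → ∀ x y, g x = g y

namespace IsBoundaryAlgebra

variable {I : Set (α → Bool)} {a b c d : α} {J : Set (β → Bool)} {a' b' c' d' : β}

theorem transpose (hI : IsBoundaryAlgebra I a b c d) : IsBoundaryAlgebra I a d c b where
  const_mem := hI.const_mem
  xor_mem := hI.xor_mem
  and_mem := hI.and_mem
  parity g hg := by
    have := hI.parity g hg
    revert this
    cases g a <;> cases g b <;> cases g c <;> cases g d <;> decide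

theorem eq_of_eq (hI : IsBoundaryAlgebra I a b c d)
    (hL : ∀ g ∈ I, g a = false → g b = false → g c = false → g d = false → ∀ x, g x = false)
    {g : α → Bool} (hg : g ∈ I) (v : Bool) (ha : g a = v) (hb : g b = v) (hc : g c = v)
    (hd : g d = v) (x : α) : g x = v := by
  have := hL _ (hI.xor_mem g hg _ (hI.const_mem v)) (by simp [ha]) (by simp [hb]) (by simp [hc])
    (by simp [hd]) x
  simpa using this

/-- A function compatible with the closure has one value on `a, b` and one on `c, d`. If the values
agree, subtracting the constant makes it vanish on the boundary; otherwise the function or its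
complement is of the excluded kind. -/
theorem closesUp_iff (hI : IsBoundaryAlgebra I a b c d) : ClosesUp I a b d c ↔
    (∀ g ∈ I, g a = false → g b = false → g c = false → g d = false → ∀ x, g x = false) ∧
      ¬ ∃ g ∈ I, g a = true ∧ g b = true ∧ g c = false ∧ g d = false := by
  constructor
  · refine fun h => ⟨fun g hg ha hb hc hd x => ?_, ?_⟩
    · rw [← ha]
      exact h g hg (by rw [ha, hb]) (by rw [hc, hd]) x a
    · rintro ⟨g, hg, ha, hb, hc, hd⟩
      have := h g hg (by rw [ha, hb]) (by rw [hc, hd]) a c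
      rw [ha, hc] at this
      cases this
  · rintro ⟨hL, hZ⟩ g hg hab hdc x y
    by_cases h : g a = g d
    · have := hI.eq_of_eq hL hg (g a) rfl hab.symm (by rw [← hdc, h]) h.symm
      rw [this, this y]
    · refine absurd ?_ hZ
      cases ha : g a
      · refine ⟨_, hI.xor_mem g hg _ (hI.const_mem true), ?_⟩
        simp_all
      · refine ⟨g, hg, ?_⟩
        simp_all

/-- Since the other closure fails, some `z` separates `a, b` from `c, d`. By parity, a function with
different values at `a` and `b` would become, after adding `z` or a constant, one that separates `a,
d` from `b, c`, which this closure forbids. -/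
theorem boundary_of_closesUp (hI : IsBoundaryAlgebra I a b c d)
    (hI' : ¬ (ClosesUp I a b d c ∧ ClosesUp I a d b c)) (h : ClosesUp I a d b c) :
    (∀ g ∈ I, g a = false → g b = false → g c = false → g d = false → ∀ x, g x = false) ∧
      ∀ g ∈ I, g a = g b ∧ g c = g d := by
  have h1 := hI.closesUp_iff
  have h2 := hI.transpose.closesUp_iff
  obtain ⟨hL, hY⟩ := h2.mp h
  have hL' : ∀ g ∈ I, g a = false → g b = false → g c = false → g d = false → ∀ x, g x = false :=
    fun g hg ha hb hc hd => hL g hg ha hd hc hb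
  obtain ⟨z, hz, hza, hzb, hzc, hzd⟩ :
      ∃ g ∈ I, g a = true ∧ g b = true ∧ g c = false ∧ g d = false := by
    by_contra hZ
    exact hI' ⟨h1.mpr ⟨hL', hZ⟩, h⟩
  have hY' : ∀ g ∈ I, ¬ (g a = true ∧ g d = true ∧ g c = false ∧ g b = false) :=
    fun g hg hh => hY ⟨g, hg, hh⟩
  refine ⟨hL', fun g hg => ?_⟩
  have p := hI.parity g hg
  have q1 := hY' g hg
  have q2 := hY' _ (hI.xor_mem g hg _ (hI.const_mem true))
  have q3 := hY' _ (hI.xor_mem g hg _ hz)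
  have q4 := hY' _ (hI.xor_mem _ (hI.xor_mem g hg _ hz) _ (hI.const_mem true))
  simp only [hza, hzb, hzc, hzd] at q3 q4
  revert p q1 q2 q3 q4
  cases g a <;> cases g b <;> cases g c <;> cases g d <;> decide

theorem exists_of_not_closesUp (hI : IsBoundaryAlgebra I a b c d)
    (hL : ∀ g ∈ I, g a = false → g b = false → g c = false → g d = false → ∀ x, g x = false)
    (h : ¬ ClosesUp I a b d c) : ∃ g ∈ I, g a = true ∧ g b = true ∧ g c = false ∧ g d = false := by
  by_contra hZ
  exact h (hI.closesUp_iff.mpr ⟨hL, hZ⟩)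

/-- The numerator closure of a horizontal sum. -/
theorem glue_closed (hI : IsBoundaryAlgebra I a b c d) (hJ : IsBoundaryAlgebra J a' b' c' d')
    (hI' : ¬ (ClosesUp I a b d c ∧ ClosesUp I a d b c))
    (hJ' : ¬ (ClosesUp J a' b' d' c' ∧ ClosesUp J a' d' b' c')) :
    (∀ g ∈ I, ∀ h ∈ J, g b = h a' → g c = h d' → g a = h b' → g d = h c' →
      ∀ x y, Sum.elim g h x = Sum.elim g h y) ↔
    (ClosesUp I a d b c ∧ ClosesUp J a' b' d' c') ∨
      (ClosesUp I a b d c ∧ ClosesUp J a' d' b' c') := by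
  constructor
  · intro H
    have hLI : ∀ g ∈ I, g a = false → g b = false → g c = false → g d = false →
        ∀ x, g x = false := fun g hg ha hb hc hd x =>
      H g hg _ (hJ.const_mem false) hb hc ha hd (.inl x) (.inr a')
    have hLJ : ∀ g ∈ J, g a' = false → g b' = false → g c' = false → g d' = false →
        ∀ x, g x = false := fun g hg ha hb hc hd x =>
      H _ (hI.const_mem false) g hg ha.symm hd.symm hb.symm hc.symm (.inr x) (.inl a)
    by_cases h1 : ClosesUp I a b d c
    · refine .inr ⟨h1, ?_⟩
      by_contra h2
      obtain ⟨g, hg, ga, gd, gc, gb⟩ := hI.transpose.exists_of_not_closesUp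
        (fun g hg ha hb hc hd => hLI g hg ha hd hc hb) (fun h => hI' ⟨h1, h⟩)
      obtain ⟨h, hh, ha, hd, hc, hb⟩ := hJ.transpose.exists_of_not_closesUp
        (fun g hg ha hb hc hd => hLJ g hg ha hd hc hb) h2
      -- The right function is complemented so that its values on the left side match those of `g`
      -- on the right side; together they give a nonconstant function on the closure.
      have := H g hg _ (hJ.xor_mem h hh _ (hJ.const_mem true)) (by simp [gb, ha])
        (by simp [gc, hd]) (by simp [ga, hb])
        (by simp [gd, hc]) (.inl a) (.inl b)
      simp [ga, gb] at this
    · obtain ⟨g, hg, ga, gb, gc, gd⟩ := hI.exists_of_not_closesUp hLI h1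
      have h2 : ClosesUp J a' b' d' c' := by
        by_contra h2
        obtain ⟨h, hh, ha, hb, hc, hd⟩ := hJ.exists_of_not_closesUp hLJ h2
        have := H g hg h hh (by rw [gb, ha]) (by rw [gc, hd]) (by rw [ga, hb]) (by rw [gd, hc])
          (.inl a) (.inl c)
        simp [ga, gc] at this
      refine .inl ⟨?_, h2⟩
      by_contra h3
      obtain ⟨f, hf, fa, fd, fc, fb⟩ := hI.transpose.exists_of_not_closesUp
        (fun g hg ha hb hc hd => hLI g hg ha hd hc hb) h3
      -- The product of the two separating functions is nonzero at `a` only, which violates parity.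
      have := hI.parity _ (hI.and_mem g hg f hf)
      simp [ga, gb, gc, gd, fa, fb] at this
  · rintro (⟨h1, h2⟩ | ⟨h1, h2⟩) g hg h hh e1 e2 e3 e4
    · obtain ⟨hLI, hgI⟩ := hI.boundary_of_closesUp hI' h1
      obtain ⟨hLJ, hgJ⟩ := hJ.transpose.boundary_of_closesUp (fun h => hJ' h.symm) h2
      have hg1 := hgI g hg
      have hh1 := hgJ h hh
      have hx := hI.eq_of_eq hLI hg (g a) rfl hg1.1.symm
        (by rw [e2, ← hh1.1, ← e1, hg1.1]) (by rw [e4, hh1.2, ← e3])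
      have hy := hJ.transpose.eq_of_eq hLJ hh (g a) (by rw [← e1, hg1.1])
        (by rw [← hh1.1, ← e1, hg1.1]) (by rw [hh1.2, ← e3]) e3.symm
      rintro (x | x) (y | y) <;> simp [hx, hy]
    · obtain ⟨hLJ, hgJ⟩ := hJ.boundary_of_closesUp hJ' h2
      obtain ⟨hLI, hgI⟩ := hI.transpose.boundary_of_closesUp (fun h => hI' h.symm) h1
      have hg1 := hgI g hg
      have hh1 := hgJ h hh
      have hx := hI.transpose.eq_of_eq hLI hg (g a) rfl hg1.1.symm
        (by rw [hg1.2, e1, hh1.1, ← e3]) (by rw [e1, hh1.1, ← e3])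
      have hy := hJ.eq_of_eq hLJ hh (g a) (by rw [hh1.1, ← e3]) e3.symm
        (by rw [← e4, ← hg1.1]) (by rw [← hh1.2, ← e4, ← hg1.1])
      rintro (x | x) (y | y) <;> simp [hx, hy]

/-- The denominator closure of a horizontal sum. -/
theorem glue_open (hI : IsBoundaryAlgebra I a b c d) (hJ : IsBoundaryAlgebra J a' b' c' d')
    (hI' : ¬ (ClosesUp I a b d c ∧ ClosesUp I a d b c))
    (hJ' : ¬ (ClosesUp J a' b' d' c' ∧ ClosesUp J a' d' b' c')) :
    (∀ g ∈ I, ∀ h ∈ J, g b = h a' → g c = h d' → g a = g d → h b' = h c' →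
      ∀ x y, Sum.elim g h x = Sum.elim g h y) ↔
    (ClosesUp I a d b c ∧ ClosesUp J a' d' b' c') := by
  constructor
  · intro H
    constructor
    · intro g hg had hbc x y
      exact H g hg _ (hJ.const_mem (g b)) rfl hbc.symm had rfl (.inl x) (.inl y)
    · intro h hh had hbc x y
      exact H _ (hI.const_mem (h a')) h hh rfl had rfl hbc (.inr x) (.inr y)
  · rintro ⟨h1, h2⟩ g hg h hh e1 e2 e3 e4
    obtain ⟨hLI, hgI⟩ := hI.boundary_of_closesUp hI' h1
    obtain ⟨hLJ, hgJ⟩ := hJ.boundary_of_closesUp hJ' h2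
    have hg1 := hgI g hg
    have hh1 := hgJ h hh
    have hx := hI.eq_of_eq hLI hg (g a) rfl hg1.1.symm (by rw [hg1.2, e3]) e3.symm
    have hy := hJ.eq_of_eq hLJ hh (g a) (by rw [← e1, hg1.1]) (by rw [← hh1.1, ← e1, hg1.1])
      (by rw [hh1.2, ← e2, hg1.2, e3]) (by rw [← e2, hg1.2, e3])
    rintro (x | x) (y | y) <;> simp [hx, hy]

end IsBoundaryAlgebra

end Gluing

/-! ### Parity at the endpoints -/

namespace Diagram

variable {E : Type}

theorem resolve_ne (D : Diagram E) (s : D.Crossing → Bool) {d : Dart D.Crossing D.Joint E}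
    (hd : ∀ x, d ≠ .endpoint x) : D.resolve s d ≠ d := by
  have : ∀ b i, partner b i ≠ i := by decide
  rcases d with ⟨c, i⟩ | ⟨j, b⟩ | x
  · simp [resolve, this]
  · simp [resolve]
  · exact absurd rfl (hd x)

/-- A function on the darts that changes sign along the edges and along the arcs of a state has
total value zero at the endpoints. -/
theorem sum_endpoint_eq_zero [Fintype E] {M : Type} [AddCommGroup M] (D : Diagram E)
    (s : D.Crossing → Bool) (f : Dart D.Crossing D.Joint E → M)
    (hedge : ∀ d, f d + f (D.edge d) = 0)
    (hres : ∀ d, (∀ x, d ≠ .endpoint x) → f d + f (D.resolve s d) = 0) :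
    ∑ x, f (.endpoint x) = 0 := by
  classical
  have := Fintype.ofFinite (Dart D.Crossing D.Joint E)
  -- The edge involution cancels the sum over all darts, the state involution the sum over the darts
  -- that are not endpoints; the endpoints are the difference.
  have h1 : ∑ d, f d = 0 := Finset.sum_involution (fun d _ => D.edge d) (fun d _ => hedge d)
    (fun d _ _ => D.edge_ne d) (fun _ _ => Finset.mem_univ _) fun d _ => D.edge_edge d
  have h2 : ∑ d ∈ Finset.univ.filter (fun d => ∀ x, d ≠ .endpoint x), f d = 0 := by
    refine Finset.sum_involution (fun d _ => D.resolve s d)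
      (fun d hd => hres d (Finset.mem_filter.mp hd).2)
      (fun d hd _ => D.resolve_ne s (Finset.mem_filter.mp hd).2) (fun d hd => ?_)
      fun d _ => D.resolve_resolve s d
    have hd := (Finset.mem_filter.mp hd).2
    rw [Finset.mem_filter]
    refine ⟨Finset.mem_univ _, fun x hx => hd x ?_⟩
    rw [← D.resolve_resolve s d, hx]
    rfl
  have h3 := Finset.sum_filter_add_sum_filter_not Finset.univ
    (fun d : Dart D.Crossing D.Joint E => ∀ x, d ≠ .endpoint x) f
  rw [h1, h2, zero_add] at h3
  rw [← h3]
  refine Finset.sum_bij (fun x _ => .endpoint x) (by simp) (by simp) ?_ fun _ _ => rfl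
  intro d hd
  simpa [eq_comm] using hd

end Diagram

theorem sum_endpoint {M : Type} [AddCommMonoid M] (f : Endpoint → M) :
    ∑ x, f x = f .NW + (f .NE + (f .SE + f .SW)) := by
  rw [show (Finset.univ : Finset Endpoint) = {.NW, .NE, .SE, .SW} from rfl,
    Finset.sum_insert (by simp), Finset.sum_insert (by simp), Finset.sum_pair (by simp)]

/-! ### States of tangles and their closures under sum and product -/

namespace TangleDiagram

open Endpoint

/-- The functions that are constant on the components of the state `s`. -/
def invariants (T : TangleDiagram) (s : T.Crossing → Bool) :
    Set (Dart T.Crossing T.Joint Endpoint → Bool) :=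
  {g | (∀ d, g (Diagram.resolve T s d) = g d) ∧ ∀ d, g (T.edge d) = g d}

theorem isBoundaryAlgebra_invariants (T : TangleDiagram) (s : T.Crossing → Bool) :
    IsBoundaryAlgebra (T.invariants s) (.endpoint NW) (.endpoint NE) (.endpoint SE)
      (.endpoint SW) where
  const_mem v := ⟨fun _ => rfl, fun _ => rfl⟩
  xor_mem g hg h hh :=
    ⟨fun d => congrArg₂ xor (hg.1 d) (hh.1 d), fun d => congrArg₂ xor (hg.2 d) (hh.2 d)⟩
  and_mem g hg h hh :=
    ⟨fun d => congrArg₂ and (hg.1 d) (hh.1 d), fun d => congrArg₂ and (hg.2 d) (hh.2 d)⟩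
  parity g hg := by
    have h2 : ∀ b : Bool, (if b then (1 : ZMod 2) else 0) + (if b then 1 else 0) = 0 := by decide
    have := Diagram.sum_endpoint_eq_zero T s (fun d => if g d then (1 : ZMod 2) else 0)
      (fun d => by simp only [hg.2, h2]) fun d _ => by simp only [hg.1, h2]
    rw [sum_endpoint] at this
    revert this
    generalize g (.endpoint NW) = a
    generalize g (.endpoint NE) = b
    generalize g (.endpoint SE) = c
    generalize g (.endpoint SW) = d
    revert a b c d
    decide

/-- The numerator closure of the state `s` is one circle. -/
def NumOne (T : TangleDiagram) (s : T.Crossing → Bool) : Prop :=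
  ClosesUp (T.invariants s) (.endpoint NW) (.endpoint NE) (.endpoint SW) (.endpoint SE)

/-- The denominator closure of the state `s` is one circle. -/
def DenOne (T : TangleDiagram) (s : T.Crossing → Bool) : Prop :=
  ClosesUp (T.invariants s) (.endpoint NW) (.endpoint SW) (.endpoint NE) (.endpoint SE)

/-- No state of the tangle diagram has one circle in both closures. -/
def IsTame (T : TangleDiagram) : Prop := ∀ s, ¬ (T.NumOne s ∧ T.DenOne s)

/-- The closing joints impose exactly the two equalities at the endpoints that occur in `ClosesUp`.
-/
theorem loops_numerator_eq_one_iff (T : TangleDiagram) (s : T.Crossing → Bool) :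
    LinkDiagram.loops T.numerator s = 1 ↔ T.NumOne s := by
  have hne : Nonempty (Dart T.Crossing T.Joint Endpoint) := ⟨.endpoint NW⟩
  let e := numeratorEquiv T.Crossing T.Joint
  have he : ∀ d : Dart T.Crossing T.Joint Endpoint, e.symm (T.numerator.edge (e d)) = T.edge d := by
    intro d
    change e.symm (e (T.edge (e.symm (e d)))) = T.edge d
    rw [Equiv.symm_apply_apply, Equiv.symm_apply_apply]
  refine (Iff.of_eq (congrArg (· = 1) (LinkDiagram.loops_eq _ _))).trans
    ((numOrbits_pair_eq_one_iff_of_equiv e _ _).trans ?_)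
  constructor
  · intro h g hg h1 h2
    refine h g ?_ fun d => (congrArg g (he d)).trans (hg.2 d)
    rintro (⟨c, i⟩ | ⟨j, b⟩ | (_ | _ | _ | _))
    exacts [hg.1 (.crossing c i), hg.1 (.joint j b), h1.symm, h1, h2, h2.symm]
  · intro h g hg hg'
    refine h g ⟨?_, fun d => (congrArg g (he d)).symm.trans (hg' d)⟩ (hg (.endpoint NE))
      (hg (.endpoint SE))
    rintro (⟨c, i⟩ | ⟨j, b⟩ | x)
    exacts [hg (.crossing c i), hg (.joint j b), rfl]

theorem loops_denominator_eq_one_iff (T : TangleDiagram) (s : T.Crossing → Bool) :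
    LinkDiagram.loops T.denominator s = 1 ↔ T.DenOne s := by
  have hne : Nonempty (Dart T.Crossing T.Joint Endpoint) := ⟨.endpoint NW⟩
  let e := denominatorEquiv T.Crossing T.Joint
  have he : ∀ d : Dart T.Crossing T.Joint Endpoint, e.symm (T.denominator.edge (e d)) = T.edge d := by
    intro d
    change e.symm (e (T.edge (e.symm (e d)))) = T.edge d
    rw [Equiv.symm_apply_apply, Equiv.symm_apply_apply]
  refine (Iff.of_eq (congrArg (· = 1) (LinkDiagram.loops_eq _ _))).trans
    ((numOrbits_pair_eq_one_iff_of_equiv e _ _).trans ?_)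
  constructor
  · intro h g hg h1 h2
    refine h g ?_ fun d => (congrArg g (he d)).trans (hg.2 d)
    rintro (⟨c, i⟩ | ⟨j, b⟩ | (_ | _ | _ | _))
    exacts [hg.1 (.crossing c i), hg.1 (.joint j b), h1.symm, h2.symm, h2, h1]
  · intro h g hg hg'
    refine h g ⟨?_, fun d => (congrArg g (he d)).symm.trans (hg' d)⟩ (hg (.endpoint SW))
      (hg (.endpoint SE))
    rintro (⟨c, i⟩ | ⟨j, b⟩ | x)
    exacts [hg (.crossing c i), hg (.joint j b), rfl]

/-- The bracket of the numerator at `rootA`. -/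
noncomputable def numBracket (T : TangleDiagram) : ℂ := LinkDiagram.bracket T.numerator rootA

/-- The bracket of the denominator at `rootA`. -/
noncomputable def denBracket (T : TangleDiagram) : ℂ := LinkDiagram.bracket T.denominator rootA

open scoped Classical in
theorem numBracket_eq (T : TangleDiagram) :
    T.numBracket = ∑ s : T.Crossing → Bool, if T.NumOne s then rootA ^ weight s else 0 :=
  have : Nonempty (Dart T.numerator.Crossing T.numerator.Joint Empty) :=
    ⟨.joint (.inr true) true⟩
  (LinkDiagram.bracket_rootA _).trans <| Finset.sum_congr rfl fun s _ =>
    if_congr (T.loops_numerator_eq_one_iff s) rfl rfl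

open scoped Classical in
theorem denBracket_eq (T : TangleDiagram) :
    T.denBracket = ∑ s : T.Crossing → Bool, if T.DenOne s then rootA ^ weight s else 0 :=
  have : Nonempty (Dart T.denominator.Crossing T.denominator.Joint Empty) :=
    ⟨.joint (.inr true) true⟩
  (LinkDiagram.bracket_rootA _).trans <| Finset.sum_congr rfl fun s _ =>
    if_congr (T.loops_denominator_eq_one_iff s) rfl rfl

theorem det_numerator (T : TangleDiagram) : LinkDiagram.det T.numerator = ‖T.numBracket‖ := rfl

theorem det_denominator (T : TangleDiagram) : LinkDiagram.det T.denominator = ‖T.denBracket‖ := rfl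

section Sum

variable (R S : TangleDiagram) (s : R.Crossing → Bool) (t : S.Crossing → Bool)

theorem comp_mem_invariants_add_iff
    (g : Dart R.Crossing R.Joint Endpoint ⊕ Dart S.Crossing S.Joint Endpoint → Bool) :
    g ∘ (addEquiv _ _ _ _).symm ∈ (R.add S).invariants (Sum.elim s t) ↔
      g ∘ Sum.inl ∈ R.invariants s ∧ g ∘ Sum.inr ∈ S.invariants t ∧
        g (.inl (.endpoint NE)) = g (.inr (.endpoint NW)) ∧
        g (.inl (.endpoint SE)) = g (.inr (.endpoint SW)) := by
  constructor
  · rintro ⟨h1, h2⟩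
    refine ⟨⟨?_, fun d => ?_⟩, ⟨?_, fun d => ?_⟩, h1 (.joint (.inr false) true),
      h1 (.joint (.inr true) true)⟩
    · rintro (⟨c, i⟩ | ⟨j, b⟩ | x)
      exacts [h1 (.crossing (.inl c) i), h1 (.joint (.inl (.inl j)) b), rfl]
    · have := h2 (addEquiv _ _ _ _ (.inl d))
      simpa [add] using this
    · rintro (⟨c, i⟩ | ⟨j, b⟩ | x)
      exacts [h1 (.crossing (.inr c) i), h1 (.joint (.inl (.inr j)) b), rfl]
    · have := h2 (addEquiv _ _ _ _ (.inr d))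
      simpa [add] using this
  · rintro ⟨⟨h1, h2⟩, ⟨h3, h4⟩, h5, h6⟩
    refine ⟨?_, fun d => ?_⟩
    · rintro (⟨c | c, i⟩ | ⟨(j | j) | (_ | _), (_ | _)⟩ | x)
      exacts [h1 (.crossing c i), h3 (.crossing c i), h1 (.joint j false), h1 (.joint j true),
        h3 (.joint j false), h3 (.joint j true), h5.symm, h5, h6.symm, h6, rfl]
    · obtain ⟨d, rfl⟩ := (addEquiv R.Crossing R.Joint S.Crossing S.Joint).surjective d
      rcases d with d | d
      · simpa [add] using h2 d
      · simpa [add] using h4 d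

theorem comp_mem_invariants_mul_iff
    (g : Dart R.Crossing R.Joint Endpoint ⊕ Dart S.Crossing S.Joint Endpoint → Bool) :
    g ∘ (mulEquiv _ _ _ _).symm ∈ (R.mul S).invariants (Sum.elim s t) ↔
      g ∘ Sum.inl ∈ R.invariants s ∧ g ∘ Sum.inr ∈ S.invariants t ∧
        g (.inl (.endpoint SW)) = g (.inr (.endpoint NW)) ∧
        g (.inl (.endpoint SE)) = g (.inr (.endpoint NE)) := by
  constructor
  · rintro ⟨h1, h2⟩
    refine ⟨⟨?_, fun d => ?_⟩, ⟨?_, fun d => ?_⟩, h1 (.joint (.inr false) true),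
      h1 (.joint (.inr true) true)⟩
    · rintro (⟨c, i⟩ | ⟨j, b⟩ | x)
      exacts [h1 (.crossing (.inl c) i), h1 (.joint (.inl (.inl j)) b), rfl]
    · have := h2 (mulEquiv _ _ _ _ (.inl d))
      simpa [mul] using this
    · rintro (⟨c, i⟩ | ⟨j, b⟩ | x)
      exacts [h1 (.crossing (.inr c) i), h1 (.joint (.inl (.inr j)) b), rfl]
    · have := h2 (mulEquiv _ _ _ _ (.inr d))
      simpa [mul] using this
  · rintro ⟨⟨h1, h2⟩, ⟨h3, h4⟩, h5, h6⟩
    refine ⟨?_, fun d => ?_⟩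
    · rintro (⟨c | c, i⟩ | ⟨(j | j) | (_ | _), (_ | _)⟩ | x)
      exacts [h1 (.crossing c i), h3 (.crossing c i), h1 (.joint j false), h1 (.joint j true),
        h3 (.joint j false), h3 (.joint j true), h5.symm, h5, h6.symm, h6, rfl]
    · obtain ⟨d, rfl⟩ := (mulEquiv R.Crossing R.Joint S.Crossing S.Joint).surjective d
      rcases d with d | d
      · simpa [mul] using h2 d
      · simpa [mul] using h4 d

/-- A closure of a diagram that is cut into two pieces, in terms of functions on the pieces. -/
theorem closesUp_iff_of_equiv {α β γ : Type} (e : α ⊕ β ≃ γ) {I : Set (γ → Bool)}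
    {J : Set (α → Bool)} {K : Set (β → Bool)} {P : (α ⊕ β → Bool) → Prop}
    (h : ∀ g, g ∘ e.symm ∈ I ↔ g ∘ Sum.inl ∈ J ∧ g ∘ Sum.inr ∈ K ∧ P g) (a b c d : α ⊕ β) :
    ClosesUp I (e a) (e b) (e c) (e d) ↔ ∀ g ∈ J, ∀ k ∈ K, P (Sum.elim g k) →
      Sum.elim g k a = Sum.elim g k b → Sum.elim g k c = Sum.elim g k d →
        ∀ x y, Sum.elim g k x = Sum.elim g k y := by
  constructor
  · intro H g hg k hk hP h1 h2 x y
    have := H (Sum.elim g k ∘ e.symm) ((h _).mpr ⟨hg, hk, hP⟩) (by simpa using h1)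
      (by simpa using h2) (e x) (e y)
    simpa using this
  · intro H g hg h1 h2 x y
    have hg' : (g ∘ e) ∘ e.symm ∈ I := by
      rwa [Function.comp_assoc, Equiv.self_comp_symm, Function.comp_id]
    obtain ⟨hJ, hK, hP⟩ := (h _).mp hg'
    have := H _ hJ _ hK (by rwa [Sum.elim_comp_inl_inr])
    rw [Sum.elim_comp_inl_inr] at this
    simpa using this h1 h2 (e.symm x) (e.symm y)

variable {R S}

theorem numOne_add (hR : R.IsTame) (hS : S.IsTame) : (R.add S).NumOne (Sum.elim s t) ↔
    (R.DenOne s ∧ S.NumOne t) ∨ (R.NumOne s ∧ S.DenOne t) := by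
  refine (closesUp_iff_of_equiv (addEquiv _ _ _ _) (comp_mem_invariants_add_iff R S s t)
    (.inl (.endpoint NW)) (.inr (.endpoint NE)) (.inl (.endpoint SW))
    (.inr (.endpoint SE))).trans (.trans ?_ (IsBoundaryAlgebra.glue_closed
      (R.isBoundaryAlgebra_invariants s) (S.isBoundaryAlgebra_invariants t) (hR s) (hS t)))
  exact ⟨fun H g hg k hk h1 h2 h3 h4 => H g hg k hk ⟨h1, h2⟩ h3 h4,
    fun H g hg k hk h1 h3 h4 => H g hg k hk h1.1 h1.2 h3 h4⟩

theorem denOne_add (hR : R.IsTame) (hS : S.IsTame) : (R.add S).DenOne (Sum.elim s t) ↔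
    R.DenOne s ∧ S.DenOne t := by
  refine (closesUp_iff_of_equiv (addEquiv _ _ _ _) (comp_mem_invariants_add_iff R S s t)
    (.inl (.endpoint NW)) (.inl (.endpoint SW)) (.inr (.endpoint NE))
    (.inr (.endpoint SE))).trans (.trans ?_ (IsBoundaryAlgebra.glue_open
      (R.isBoundaryAlgebra_invariants s) (S.isBoundaryAlgebra_invariants t) (hR s) (hS t)))
  exact ⟨fun H g hg k hk h1 h2 h3 h4 => H g hg k hk ⟨h1, h2⟩ h3 h4,
    fun H g hg k hk h1 h3 h4 => H g hg k hk h1.1 h1.2 h3 h4⟩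

/-- Reflection in the NW–SE diagonal exchanges NE with SW, hence products with sums and denominators
with numerators; `transpose` carries this out. -/
theorem denOne_mul (hR : R.IsTame) (hS : S.IsTame) : (R.mul S).DenOne (Sum.elim s t) ↔
    (R.NumOne s ∧ S.DenOne t) ∨ (R.DenOne s ∧ S.NumOne t) := by
  refine (closesUp_iff_of_equiv (mulEquiv _ _ _ _) (comp_mem_invariants_mul_iff R S s t)
    (.inl (.endpoint NW)) (.inr (.endpoint SW)) (.inl (.endpoint NE))
    (.inr (.endpoint SE))).trans (.trans ?_ (IsBoundaryAlgebra.glue_closed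
      (R.isBoundaryAlgebra_invariants s).transpose (S.isBoundaryAlgebra_invariants t).transpose
      (fun h => hR s h.symm) (fun h => hS t h.symm)))
  exact ⟨fun H g hg k hk h1 h2 h3 h4 => H g hg k hk ⟨h1, h2⟩ h3 h4,
    fun H g hg k hk h1 h3 h4 => H g hg k hk h1.1 h1.2 h3 h4⟩

theorem numOne_mul (hR : R.IsTame) (hS : S.IsTame) : (R.mul S).NumOne (Sum.elim s t) ↔
    R.NumOne s ∧ S.NumOne t := by
  refine (closesUp_iff_of_equiv (mulEquiv _ _ _ _) (comp_mem_invariants_mul_iff R S s t)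
    (.inl (.endpoint NW)) (.inl (.endpoint NE)) (.inr (.endpoint SW))
    (.inr (.endpoint SE))).trans (.trans ?_ (IsBoundaryAlgebra.glue_open
      (R.isBoundaryAlgebra_invariants s).transpose (S.isBoundaryAlgebra_invariants t).transpose
      (fun h => hR s h.symm) (fun h => hS t h.symm)))
  exact ⟨fun H g hg k hk h1 h2 h3 h4 => H g hg k hk ⟨h1, h2⟩ h3 h4,
    fun H g hg k hk h1 h3 h4 => H g hg k hk h1.1 h1.2 h3 h4⟩

theorem IsTame.add (hR : R.IsTame) (hS : S.IsTame) : (R.add S).IsTame := by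
  intro u h
  obtain ⟨⟨s, t⟩, rfl⟩ := (Equiv.sumArrowEquivProdArrow R.Crossing S.Crossing Bool).symm.surjective u
  have h1 := (numOne_add s t hR hS).mp h.1
  have h2 := (denOne_add s t hR hS).mp h.2
  have := hR s
  have := hS t
  tauto

theorem IsTame.mul (hR : R.IsTame) (hS : S.IsTame) : (R.mul S).IsTame := by
  intro u h
  obtain ⟨⟨s, t⟩, rfl⟩ := (Equiv.sumArrowEquivProdArrow R.Crossing S.Crossing Bool).symm.surjective u
  have h1 := (numOne_mul s t hR hS).mp h.1
  have h2 := (denOne_mul s t hR hS).mp h.2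
  have := hR s
  have := hS t
  tauto

end Sum

end TangleDiagram

/-! ### Brackets of sums, products and rational tangles -/

namespace TangleDiagram

open Endpoint

section Brackets

variable {R S : TangleDiagram}

theorem weight_sumElim {C C' : Type} [Fintype C] [Fintype C'] (s : C → Bool) (t : C' → Bool) :
    weight (Sum.elim s t) = weight s + weight t := by
  rw [weight, Fintype.sum_sum_type]
  rfl

theorem sum_states_eq {C C' : Type} [Fintype C] [Fintype C'] [DecidableEq C] [DecidableEq C']
    (f : (C ⊕ C' → Bool) → ℂ) : ∑ u, f u = ∑ s : C → Bool, ∑ t : C' → Bool, f (Sum.elim s t) := by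
  rw [← (Equiv.sumArrowEquivProdArrow C C' Bool).symm.sum_comp, Fintype.sum_prod_type]
  rfl

theorem numBracket_add (hR : R.IsTame) (hS : S.IsTame) : (R.add S).numBracket =
    R.denBracket * S.numBracket + R.numBracket * S.denBracket := by
  classical
  refine (numBracket_eq _).trans ((sum_states_eq _).trans ?_)
  rw [numBracket_eq, numBracket_eq, denBracket_eq, denBracket_eq, Finset.sum_mul_sum,
    Finset.sum_mul_sum, ← Finset.sum_add_distrib]
  refine Finset.sum_congr rfl fun s _ => ?_
  rw [← Finset.sum_add_distrib]
  refine Finset.sum_congr rfl fun t _ => ?_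
  refine (if_congr (numOne_add s t hR hS)
    (congrArg (rootA ^ ·) (weight_sumElim s t)) rfl).trans ?_
  -- Tameness makes the two alternatives of `numOne_add` exclusive, so the indicator of their
  -- disjunction is the sum of their indicators.
  have := hR s
  rw [zpow_add₀ rootA_ne_zero]
  split_ifs <;> simp_all

theorem denBracket_add (hR : R.IsTame) (hS : S.IsTame) : (R.add S).denBracket =
    R.denBracket * S.denBracket := by
  classical
  refine (denBracket_eq _).trans ((sum_states_eq _).trans ?_)
  rw [denBracket_eq, denBracket_eq, Finset.sum_mul_sum]
  refine Finset.sum_congr rfl fun s _ => Finset.sum_congr rfl fun t _ => ?_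
  refine (if_congr (denOne_add s t hR hS)
    (congrArg (rootA ^ ·) (weight_sumElim s t)) rfl).trans ?_
  rw [zpow_add₀ rootA_ne_zero]
  split_ifs <;> simp_all

theorem denBracket_mul (hR : R.IsTame) (hS : S.IsTame) : (R.mul S).denBracket =
    R.numBracket * S.denBracket + R.denBracket * S.numBracket := by
  classical
  refine (denBracket_eq _).trans ((sum_states_eq _).trans ?_)
  rw [numBracket_eq, numBracket_eq, denBracket_eq, denBracket_eq, Finset.sum_mul_sum,
    Finset.sum_mul_sum, ← Finset.sum_add_distrib]
  refine Finset.sum_congr rfl fun s _ => ?_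
  rw [← Finset.sum_add_distrib]
  refine Finset.sum_congr rfl fun t _ => ?_
  refine (if_congr (denOne_mul s t hR hS)
    (congrArg (rootA ^ ·) (weight_sumElim s t)) rfl).trans ?_
  have := hR s
  rw [zpow_add₀ rootA_ne_zero]
  split_ifs <;> simp_all

theorem numBracket_mul (hR : R.IsTame) (hS : S.IsTame) : (R.mul S).numBracket =
    R.numBracket * S.numBracket := by
  classical
  refine (numBracket_eq _).trans ((sum_states_eq _).trans ?_)
  rw [numBracket_eq, numBracket_eq, Finset.sum_mul_sum]
  refine Finset.sum_congr rfl fun s _ => Finset.sum_congr rfl fun t _ => ?_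
  refine (if_congr (numOne_mul s t hR hS)
    (congrArg (rootA ^ ·) (weight_sumElim s t)) rfl).trans ?_
  rw [zpow_add₀ rootA_ne_zero]
  split_ifs <;> simp_all

end Brackets

theorem not_numOne_zero (s : zero.Crossing → Bool) : ¬ zero.NumOne s := by
  intro h
  let g : Dart zero.Crossing zero.Joint Endpoint → Bool
    | .endpoint NW => true
    | .endpoint NE => true
    | _ => false
  have hg : g ∈ zero.invariants s := by
    constructor <;> rintro (⟨⟨⟩⟩ | ⟨⟨⟩⟩ | (_ | _ | _ | _)) <;> rfl
  exact absurd (h g hg rfl rfl (.endpoint NW) (.endpoint SW)) (by simp [g])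

theorem denOne_zero (s : zero.Crossing → Bool) : zero.DenOne s := by
  rintro g ⟨-, hg⟩ h1 h2
  have e1 : g (.endpoint NE) = g (.endpoint NW) := hg (.endpoint NW)
  have e2 : g (.endpoint SE) = g (.endpoint SW) := hg (.endpoint SW)
  have : ∀ x, g x = g (.endpoint NW) := by
    rintro (⟨⟨⟩⟩ | ⟨⟨⟩⟩ | (_ | _ | _ | _))
    exacts [rfl, e1, e2.trans h1.symm, h1.symm]
  intro x y
  rw [this, this y]

theorem numOne_infty (s : infty.Crossing → Bool) : infty.NumOne s := by
  rintro g ⟨-, hg⟩ h1 h2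
  have e1 : g (.endpoint SW) = g (.endpoint NW) := hg (.endpoint NW)
  have e2 : g (.endpoint SE) = g (.endpoint NE) := hg (.endpoint NE)
  have : ∀ x, g x = g (.endpoint NW) := by
    rintro (⟨⟨⟩⟩ | ⟨⟨⟩⟩ | (_ | _ | _ | _))
    exacts [rfl, h1.symm, e2.trans h1.symm, e1]
  intro x y
  rw [this, this y]

theorem not_denOne_infty (s : infty.Crossing → Bool) : ¬ infty.DenOne s := by
  intro h
  let g : Dart infty.Crossing infty.Joint Endpoint → Bool
    | .endpoint NW => true
    | .endpoint SW => true
    | _ => false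
  have hg : g ∈ infty.invariants s := by
    constructor <;> rintro (⟨⟨⟩⟩ | ⟨⟨⟩⟩ | (_ | _ | _ | _)) <;> rfl
  exact absurd (h g hg rfl rfl (.endpoint NW) (.endpoint NE)) (by simp [g])

/-- The function on the darts of `±1` with given values at the ends of the crossing. -/
def unitFunction (ε : Bool) (f : ZMod 4 → Bool) :
    Dart (unit ε).Crossing (unit ε).Joint Endpoint → Bool
  | .crossing _ i => f i
  | .endpoint x => f (endAt x)

theorem unitFunction_mem (ε : Bool) (f : ZMod 4 → Bool) (s : Unit → Bool)
    (h : ∀ i, f (Diagram.partner (s () == ε) i) = f i) :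
    unitFunction ε f ∈ (unit ε).invariants s := by
  have hc : ∀ i, endAt (cornerOf i) = i := by decide
  constructor
  · rintro (⟨⟨⟩, i⟩ | ⟨⟨⟩⟩ | x)
    exacts [h i, rfl]
  · rintro (⟨⟨⟩, i⟩ | ⟨⟨⟩⟩ | x)
    exacts [congrArg f (hc i), rfl]

theorem eq_unitFunction (ε : Bool) (s : Unit → Bool)
    {g : Dart (unit ε).Crossing (unit ε).Joint Endpoint → Bool} (hg : g ∈ (unit ε).invariants s) :
    ∃ f : ZMod 4 → Bool, g = unitFunction ε f ∧
      ∀ i, f (Diagram.partner (s () == ε) i) = f i := by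
  refine ⟨fun i => g (.crossing () i), ?_, fun i => hg.1 (.crossing () i)⟩
  funext d
  rcases d with ⟨⟨⟩, i⟩ | ⟨⟨⟩⟩ | x
  exacts [rfl, (hg.2 (.endpoint x)).symm]

/-- The smoothing `ε` of `±1` is the tangle `∞`, whose numerator is a circle; the other smoothing is
the tangle `0`. -/
theorem numOne_unit_iff (ε : Bool) (s : Unit → Bool) : (unit ε).NumOne s ↔ s () = ε := by
  constructor
  · intro h
    by_contra hs
    have hb : (s () == ε) = false := by simpa using hs
    have := h _ (unitFunction_mem ε (fun i => decide (i = 0 ∨ i = 3)) s (by rw [hb]; decide))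
      rfl rfl (.endpoint NW) (.endpoint SW)
    simp [unitFunction, endAt] at this
    exact absurd this (by decide)
  · intro hs g hg h1 h2
    obtain ⟨f, rfl, hf⟩ := eq_unitFunction ε s hg
    rw [hs, beq_self_eq_true] at hf
    have e0 : f 1 = f 0 := hf 0
    have e2 : f 3 = f 2 := hf 2
    have e3 : f 0 = f 3 := h1
    have key : ∀ i, f i = f 0 := by
      intro i
      fin_cases i
      exacts [rfl, e0, (e3.trans e2).symm, e3.symm]
    have : ∀ d, unitFunction ε f d = f 0 := by
      rintro (⟨⟨⟩, i⟩ | ⟨⟨⟩⟩ | x)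
      exacts [key i, key _]
    intro x y
    rw [this, this y]

theorem denOne_unit_iff (ε : Bool) (s : Unit → Bool) : (unit ε).DenOne s ↔ s () = !ε := by
  constructor
  · intro h
    by_contra hs
    have hb : (s () == ε) = true := by simpa using hs
    have := h _ (unitFunction_mem ε (fun i => decide (i = 0 ∨ i = 1)) s (by rw [hb]; decide))
      rfl rfl (.endpoint NW) (.endpoint NE)
    simp [unitFunction, endAt] at this
    exact absurd this (by decide)
  · intro hs g hg h1 h2
    obtain ⟨f, rfl, hf⟩ := eq_unitFunction ε s hg
    have hb : (s () == ε) = false := by simp [hs]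
    rw [hb] at hf
    have e0 : f 3 = f 0 := hf 0
    have e2 : f 2 = f 1 := hf 1
    have e3 : f 0 = f 1 := h1
    have key : ∀ i, f i = f 0 := by
      intro i
      fin_cases i
      exacts [rfl, e3.symm, e2.trans e3.symm, e0]
    have : ∀ d, unitFunction ε f d = f 0 := by
      rintro (⟨⟨⟩, i⟩ | ⟨⟨⟩⟩ | x)
      exacts [key i, key _]
    intro x y
    rw [this, this y]

/-- The tangle diagram behaves as a diagram of the rational tangle `p / q`. -/
structure HasFraction (R : TangleDiagram) (p q : ℤ) : Prop where
  isTame : R.IsTame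
  brackets : ∃ u : ℂ, ‖u‖ = 1 ∧ R.numBracket = Complex.I * p * u ∧ R.denBracket = q * u

theorem hasFraction_zero : HasFraction zero 0 1 := by
  classical
  refine ⟨fun s h => not_numOne_zero s h.1, 1, norm_one, ?_, ?_⟩
  · rw [numBracket_eq, Finset.sum_eq_zero fun s _ => if_neg (not_numOne_zero s)]
    simp
  · refine ((denBracket_eq _).trans (Finset.sum_congr rfl fun s _ =>
      if_pos (denOne_zero s))).trans ?_
    change ∑ s : Empty → Bool, rootA ^ weight s = _
    simp [weight]

theorem hasFraction_infty : HasFraction infty 1 0 := by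
  classical
  -- The numerator bracket is `1`, so the unit has to cancel the factor `i`.
  refine ⟨fun s h => not_denOne_infty s h.2, -Complex.I, by simp, ?_, ?_⟩
  · refine ((numBracket_eq _).trans (Finset.sum_congr rfl fun s _ =>
      if_pos (numOne_infty s))).trans ?_
    change ∑ s : Empty → Bool, rootA ^ weight s = _
    simp [weight]
  · rw [denBracket_eq, Finset.sum_eq_zero fun s _ => if_neg (not_denOne_infty s)]
    simp

theorem hasFraction_unit (ε : Bool) : HasFraction (unit ε) (if ε then 1 else -1) 1 := by
  classical
  have hsum : ∀ f : (Unit → Bool) → ℂ, ∑ s, f s = f (fun _ => true) + f fun _ => false := by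
    intro f
    rw [← (Equiv.funUnique Unit Bool).symm.sum_comp, Fintype.sum_bool]
    rfl
  have hn : (unit ε).numBracket = rootA ^ (if ε then 1 else -1 : ℤ) := by
    refine ((numBracket_eq _).trans (Finset.sum_congr rfl fun s _ =>
      if_congr (numOne_unit_iff ε s) rfl rfl)).trans ?_
    refine (hsum fun s => if s () = ε then rootA ^ weight s else 0).trans ?_
    cases ε <;> simp [weight]
  have hd : (unit ε).denBracket = rootA ^ (if ε then -1 else 1 : ℤ) := by
    refine ((denBracket_eq _).trans (Finset.sum_congr rfl fun s _ =>
      if_congr (denOne_unit_iff ε s) rfl rfl)).trans ?_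
    refine (hsum fun s => if s () = !ε then rootA ^ weight s else 0).trans ?_
    cases ε <;> simp [weight]
  refine ⟨fun s h => ?_, rootA ^ (if ε then -1 else 1 : ℤ), norm_rootA_zpow _, ?_, ?_⟩
  · have h1 := (numOne_unit_iff ε s).mp h.1
    have h2 := (denOne_unit_iff ε s).mp h.2
    rw [h1] at h2
    cases ε <;> cases h2
  · rw [hn]
    cases ε
    · simp [rootA_inv]
    · simp only [if_true, zpow_one, zpow_neg_one, rootA_inv]
      push_cast
      linear_combination rootA * Complex.I_mul_I
  · rw [hd]
    simp

theorem HasFraction.neg {R : TangleDiagram} {p q : ℤ} (h : HasFraction R p q) :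
    HasFraction R (-p) (-q) := by
  obtain ⟨ht, u, hu, h1, h2⟩ := h
  refine ⟨ht, -u, by rwa [norm_neg], ?_, ?_⟩
  · rw [h1]; push_cast; ring
  · rw [h2]; push_cast; ring

theorem HasFraction.add {R S : TangleDiagram} {p q p' q' : ℤ} (h : HasFraction R p q)
    (h' : HasFraction S p' q') : HasFraction (R.add S) (p * q' + q * p') (q * q') := by
  obtain ⟨ht, u, hu, h1, h2⟩ := h
  obtain ⟨ht', u', hu', h1', h2'⟩ := h'
  refine ⟨ht.add ht', u * u', by rw [norm_mul, hu, hu', one_mul], ?_, ?_⟩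
  · rw [numBracket_add ht ht', h1, h2, h1', h2']; push_cast; ring
  · rw [denBracket_add ht ht', h2, h2']; push_cast; ring

/-- The reciprocals of the fractions add. The product of two numerators contains `i²`, one factor of
which is moved into the unit. -/
theorem HasFraction.mul {R S : TangleDiagram} {p q p' q' : ℤ} (h : HasFraction R p q)
    (h' : HasFraction S p' q') : HasFraction (R.mul S) (p * p') (p * q' + q * p') := by
  obtain ⟨ht, u, hu, h1, h2⟩ := h
  obtain ⟨ht', u', hu', h1', h2'⟩ := h'
  refine ⟨ht.mul ht', Complex.I * (u * u'), by simp [hu, hu'], ?_, ?_⟩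
  · rw [numBracket_mul ht ht', h1, h1']; push_cast; ring
  · rw [denBracket_mul ht ht', h1, h2, h1', h2']; push_cast; ring

theorem HasFraction.congr {R : TangleDiagram} {p q p' q' : ℤ} (h : HasFraction R p q)
    (hp : p = p') (hq : q = q') : HasFraction R p' q' := hp ▸ hq ▸ h

theorem hasFraction_rowOf (ε : Bool) (n : ℕ) :
    HasFraction (rowOf ε n) (if ε then n else -n) 1 := by
  induction n with
  | zero => exact hasFraction_zero.congr (by simp) rfl
  | succ n ih =>
    refine (ih.add (hasFraction_unit ε)).congr ?_ rfl
    cases ε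
    · simp
      ring
    · simp

theorem hasFraction_columnOf (ε : Bool) (n : ℕ) :
    HasFraction (columnOf ε n) 1 (if ε then n else -n) := by
  induction n with
  | zero => exact hasFraction_infty.congr rfl (by simp)
  | succ n ih =>
    have := ih.mul (hasFraction_unit ε)
    cases ε
    -- The product has the pair `(-1, n + 1)`, whose sign is absorbed by the unit.
    · exact this.neg.congr (by simp) (by simp; ring)
    · exact this.congr (by simp) (by simp; ring)

theorem ite_natAbs (a : ℤ) :
    (if decide (0 ≤ a) = true then (a.natAbs : ℤ) else -(a.natAbs : ℤ)) = a := by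
  by_cases h : 0 ≤ a
  · rw [if_pos (decide_eq_true h)]
    omega
  · rw [if_neg (by simpa using h)]
    omega

theorem hasFraction_integral (a : ℤ) : HasFraction (integral a) a 1 :=
  (hasFraction_rowOf (decide (0 ≤ a)) a.natAbs).congr (ite_natAbs a) rfl

theorem hasFraction_vertical (a : ℤ) : HasFraction (vertical a) 1 a :=
  (hasFraction_columnOf (decide (0 ≤ a)) a.natAbs).congr rfl (ite_natAbs a)

/-- Numerator and denominator of the continued fraction `[a₁, …, aₙ]`. -/
def cfPair : List ℤ → ℤ × ℤ
  | [] => (1, 0)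
  | a :: as => (a * (cfPair as).1 + (cfPair as).2, (cfPair as).1)

theorem hasFraction_rationalAux (as : List ℤ) :
    HasFraction (rationalAux true as) (cfPair as).1 (cfPair as).2 ∧
      HasFraction (rationalAux false as) (cfPair as).2 (cfPair as).1 := by
  induction as with
  | nil => exact ⟨hasFraction_infty, hasFraction_zero⟩
  | cons a as ih =>
    exact ⟨(ih.2.add (hasFraction_integral a)).congr (by simp only [cfPair]; ring)
      (by simp only [cfPair]; ring), (ih.1.mul (hasFraction_vertical a)).congr
      (by simp only [cfPair]; ring) (by simp only [cfPair]; ring)⟩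

theorem isCoprime_cfPair (as : List ℤ) : IsCoprime (cfPair as).1 (cfPair as).2 := by
  induction as with
  | nil => exact isCoprime_one_left
  | cons a as ih => simpa [cfPair, add_comm, mul_comm] using ih.symm.add_mul_left_left a

theorem cfValue_pos : ∀ as : List ℤ, as ≠ [] → (∀ a ∈ as, 0 < a) → 0 < cfValue as
  | [], h, _ => absurd rfl h
  | [a], _, h => by simpa [cfValue] using h a (by simp)
  | a :: b :: as, _, h => by
    have h1 := cfValue_pos (b :: as) (by simp) fun x hx => h x (List.mem_cons_of_mem _ hx)
    have h2 : (0 : ℚ) < a := by exact_mod_cast h a (by simp)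
    rw [cfValue]
    positivity

theorem cfValue_neg : ∀ as : List ℤ, as ≠ [] → (∀ a ∈ as, a < 0) → cfValue as < 0
  | [], h, _ => absurd rfl h
  | [a], _, h => by simpa [cfValue] using h a (by simp)
  | a :: b :: as, _, h => by
    have h1 := cfValue_neg (b :: as) (by simp) fun x hx => h x (List.mem_cons_of_mem _ hx)
    have h2 : (a : ℚ) < 0 := by exact_mod_cast h a (by simp)
    have h3 := one_div_neg.mpr h1
    rw [cfValue]
    linarith

/-- Equal signs and nonzero later terms keep every tail of the continued fraction away from zero, so
that no division by zero occurs. -/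
theorem cfValue_eq (as : List ℤ) (hne : as ≠ []) (h0 : ∀ a ∈ as.tail, a ≠ 0)
    (hs : (∀ a ∈ as, 0 ≤ a) ∨ ∀ a ∈ as, a ≤ 0) :
    (cfPair as).2 ≠ 0 ∧ cfValue as = (cfPair as).1 / (cfPair as).2 := by
  induction as with
  | nil => exact absurd rfl hne
  | cons a as ih =>
    cases as with
    | nil => simp [cfPair, cfValue]
    | cons b as =>
      have h0' : ∀ x ∈ b :: as, x ≠ 0 := h0
      obtain ⟨h1, h2⟩ := ih (by simp) (fun x hx => h0' x (List.mem_cons_of_mem _ hx))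
        (hs.imp (fun h x hx => h x (List.mem_cons_of_mem _ hx))
          fun h x hx => h x (List.mem_cons_of_mem _ hx))
      have h3 : cfValue (b :: as) ≠ 0 := by
        rcases hs with hs | hs
        · exact (cfValue_pos _ (by simp) fun x hx =>
            lt_of_le_of_ne (hs x (List.mem_cons_of_mem _ hx)) (h0' x hx).symm).ne'
        · exact (cfValue_neg _ (by simp) fun x hx =>
            lt_of_le_of_ne (hs x (List.mem_cons_of_mem _ hx)) (h0' x hx)).ne
      have h4 : ((cfPair (b :: as)).1 : ℚ) ≠ 0 := by
        intro h
        rw [h2, h, zero_div] at h3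
        exact h3 rfl
      have h5 : ((cfPair (b :: as)).2 : ℚ) ≠ 0 := by exact_mod_cast h1
      rw [cfPair, cfValue, h2]
      refine ⟨by exact_mod_cast h4, ?_⟩
      push_cast
      field_simp

/-- A standard diagram of a rational tangle has the fraction of this tangle. -/
theorem hasFraction_rational {p : ℤ} {q : ℕ} (hq : 0 < q) (hpq : IsCoprime p q) {as : List ℤ}
    (h : IsStandardExpansion ((p : ℚ) / q) as) : HasFraction (rational as) p q := by
  obtain ⟨hne, h0, hs, hv⟩ := h
  obtain ⟨h1, h2⟩ := cfValue_eq as hne h0 hs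
  have hf := (hasFraction_rationalAux as).1
  have hc := isCoprime_cfPair as
  have hq' : (q : ℚ) ≠ 0 := by positivity
  have h1' : ((cfPair as).2 : ℚ) ≠ 0 := by exact_mod_cast h1
  rw [hv, div_eq_div_iff hq' h1'] at h2
  have h3 : p * (cfPair as).2 = (cfPair as).1 * q := by exact_mod_cast h2
  -- Two coprime pairs with the same quotient agree up to a common sign, which `HasFraction.neg`
  -- absorbs.
  have d1 : (q : ℤ) ∣ (cfPair as).2 := hpq.symm.dvd_of_dvd_mul_left ⟨_, by rw [h3, mul_comm]⟩
  have d2 : (cfPair as).2 ∣ (q : ℤ) := hc.symm.dvd_of_dvd_mul_left ⟨p, by rw [← h3, mul_comm]⟩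
  have hq0 : (q : ℤ) ≠ 0 := by positivity
  rcases Int.associated_iff.mp (associated_of_dvd_dvd d2 d1) with h | h
  · have : (cfPair as).1 = p := by
      rw [h] at h3
      exact (mul_right_cancel₀ hq0 h3).symm
    rwa [this, h] at hf
  · have : (cfPair as).1 = -p := by
      rw [h] at h3
      exact mul_right_cancel₀ hq0 (by linarith)
    rw [this, h] at hf
    exact hf.neg.congr (neg_neg _) (neg_neg _)

end TangleDiagram

/-! ### The outer crossing and the weights of the two closures -/

namespace TangleDiagram

open Endpoint

/-- The endpoint that becomes the end `i` of the crossing obtained by shrinking the complementary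
disk. -/
def outerEndpoint : ZMod 4 → Endpoint := fun i => ![NW, NE, SE, SW] i

/-- The end of the outer crossing that corresponds to an endpoint. -/
def outerEnd : Endpoint → ZMod 4
  | NW => 0
  | NE => 1
  | SE => 2
  | SW => 3

theorem outerEnd_outerEndpoint : ∀ i, outerEnd (outerEndpoint i) = i := by decide

theorem outerEndpoint_outerEnd (x : Endpoint) : outerEndpoint (outerEnd x) = x := by
  cases x <;> rfl

/-- The four endpoints become the ends of an additional crossing. -/
def outerEquiv (C J : Type) : Dart C J Endpoint ≃ Dart (Option C) J Empty where
  toFun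
    | .crossing c i => .crossing (some c) i
    | .joint j b => .joint j b
    | .endpoint x => .crossing none (outerEnd x)
  invFun
    | .crossing (some c) i => .crossing c i
    | .crossing none i => .endpoint (outerEndpoint i)
    | .joint j b => .joint j b
  left_inv := by
    rintro (⟨c, i⟩ | ⟨j, b⟩ | x)
    exacts [rfl, rfl, congrArg Dart.endpoint (outerEndpoint_outerEnd x)]
  right_inv := by
    rintro (⟨_ | c, i⟩ | ⟨j, b⟩ | ⟨⟨⟩⟩)
    exacts [congrArg (Dart.crossing none) (outerEnd_outerEndpoint i), rfl, rfl]

/-- The link diagram on the sphere obtained from a tangle diagram by shrinking the complementary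
disk to a crossing. -/
def outerClosure (T : TangleDiagram) (o : Bool) : LinkDiagram where
  Crossing := Option T.Crossing
  Joint := T.Joint
  edge d := outerEquiv _ _ (T.edge ((outerEquiv _ _).symm d))
  edge_edge d := by simp [T.edge_edge]
  edge_ne d h := by
    rw [← Equiv.eq_symm_apply] at h
    exact T.edge_ne _ h
  oddOver c := c.elim o T.oddOver

variable {T : TangleDiagram}

theorem outerEquiv_edge (T : TangleDiagram) (o : Bool) (d : Dart T.Crossing T.Joint Endpoint) :
    outerEquiv T.Crossing T.Joint (T.edge d) =
      (T.outerClosure o).edge (outerEquiv T.Crossing T.Joint d) :=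
  congrArg (fun d => outerEquiv T.Crossing T.Joint (T.edge d))
    ((outerEquiv T.Crossing T.Joint).symm_apply_apply d).symm

theorem outerEquiv_rot (T : TangleDiagram) (o : Bool) (d : Dart T.Crossing T.Joint Endpoint) :
    outerEquiv T.Crossing T.Joint (Diagram.rot T clockwise d) =
      Diagram.rot (T.outerClosure o) id (outerEquiv T.Crossing T.Joint d) := by
  rcases d with ⟨c, i⟩ | ⟨j, b⟩ | (_ | _ | _ | _) <;> rfl

theorem numOrbits_outerClosure_face (T : TangleDiagram) (o : Bool) :
    numOrbits {Diagram.rot T clockwise ∘ T.edge} =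
      numOrbits {Diagram.rot (T.outerClosure o) id ∘ (T.outerClosure o).edge} :=
  numOrbits_congr_singleton (outerEquiv T.Crossing T.Joint) fun d =>
    (outerEquiv_rot T o _).trans (congrArg _ (outerEquiv_edge T o d))

theorem isPlanar_outerClosure (hT : T.IsPlanar) (o : Bool) :
    LinkDiagram.IsPlanar (T.outerClosure o) := by
  have h1 : numOrbits {Diagram.rot T clockwise} = numOrbits {Diagram.rot (T.outerClosure o) id} :=
    numOrbits_congr_singleton _ (outerEquiv_rot T o)
  have h2 : numOrbits {T.edge} = numOrbits {(T.outerClosure o).edge} :=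
    numOrbits_congr_singleton _ (outerEquiv_edge T o)
  have h3 : numOrbits {Diagram.rot T clockwise, T.edge} =
      numOrbits {Diagram.rot (T.outerClosure o) id, (T.outerClosure o).edge} :=
    numOrbits_congr_pair _ (outerEquiv_rot T o) (outerEquiv_edge T o)
  rw [IsPlanar, Diagram.EulerFormula, h1, h2, h3, numOrbits_outerClosure_face T o] at hT
  exact hT

/-- The state of the outer closure with smoothing `x` at the outer crossing. -/
def outerState (x : Bool) (s : T.Crossing → Bool) : Option T.Crossing → Bool := fun c => c.elim x s

theorem weight_outerState (x : Bool) (s : T.Crossing → Bool) :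
    weight (outerState x s) = (if x then 1 else -1) + weight s :=
  Fintype.sum_option _

/-- At the outer crossing the ends `0, 1, 2, 3` are NW, NE, SE, SW. The smoothing equal to `o` joins
`0` to `1` and `2` to `3`, as the numerator does; the opposite one gives the denominator. -/
theorem loops_outerClosure_true_iff (o : Bool) (s : T.Crossing → Bool) :
    LinkDiagram.loops (T.outerClosure o) (outerState o s) = 1 ↔ T.NumOne s := by
  have hne : Nonempty (Dart T.Crossing T.Joint Endpoint) := ⟨.endpoint NW⟩
  let e := outerEquiv T.Crossing T.Joint
  have he : ∀ d : Dart T.Crossing T.Joint Endpoint,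
      e.symm ((T.outerClosure o).edge (e d)) = T.edge d := fun d =>
    e.symm_apply_eq.mpr (outerEquiv_edge T o d).symm
  have hr : ∀ x, e.symm (Diagram.resolve (T.outerClosure o) (outerState o s) (e (.endpoint x))) =
      .endpoint (outerEndpoint (Diagram.partner true (outerEnd x))) := by
    intro x
    have : (o == o) = true := by simp
    rw [← this]
    rfl
  refine (Iff.of_eq (congrArg (· = 1) (LinkDiagram.loops_eq _ _))).trans
    ((numOrbits_pair_eq_one_iff_of_equiv e _ _).trans ?_)
  constructor
  · intro h g hg h1 h2
    refine h g ?_ fun d => (congrArg g (he d)).trans (hg.2 d)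
    rintro (⟨c, i⟩ | ⟨j, b⟩ | x)
    · exact hg.1 (.crossing c i)
    · exact hg.1 (.joint j b)
    · refine (congrArg g (hr x)).trans ?_
      cases x
      exacts [h1.symm, h1, h2, h2.symm]
  · intro h g hg hg'
    refine h g ⟨?_, fun d => (congrArg g (he d)).symm.trans (hg' d)⟩
      ((congrArg g (hr NE)).symm.trans (hg (.endpoint NE)))
      ((congrArg g (hr SE)).symm.trans (hg (.endpoint SE)))
    rintro (⟨c, i⟩ | ⟨j, b⟩ | x)
    exacts [hg (.crossing c i), hg (.joint j b), rfl]

theorem loops_outerClosure_false_iff (o : Bool) (s : T.Crossing → Bool) :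
    LinkDiagram.loops (T.outerClosure o) (outerState (!o) s) = 1 ↔ T.DenOne s := by
  have hne : Nonempty (Dart T.Crossing T.Joint Endpoint) := ⟨.endpoint NW⟩
  let e := outerEquiv T.Crossing T.Joint
  have he : ∀ d : Dart T.Crossing T.Joint Endpoint,
      e.symm ((T.outerClosure o).edge (e d)) = T.edge d := fun d =>
    e.symm_apply_eq.mpr (outerEquiv_edge T o d).symm
  have hr : ∀ x, e.symm (Diagram.resolve (T.outerClosure o) (outerState (!o) s)
      (e (.endpoint x))) = .endpoint (outerEndpoint (Diagram.partner false (outerEnd x))) := by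
    intro x
    have : ((!o) == o) = false := by cases o <;> rfl
    rw [← this]
    rfl
  refine (Iff.of_eq (congrArg (· = 1) (LinkDiagram.loops_eq _ _))).trans
    ((numOrbits_pair_eq_one_iff_of_equiv e _ _).trans ?_)
  constructor
  · intro h g hg h1 h2
    refine h g ?_ fun d => (congrArg g (he d)).trans (hg.2 d)
    rintro (⟨c, i⟩ | ⟨j, b⟩ | x)
    · exact hg.1 (.crossing c i)
    · exact hg.1 (.joint j b)
    · refine (congrArg g (hr x)).trans ?_
      cases x
      exacts [h1.symm, h2.symm, h2, h1]
  · intro h g hg hg'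
    refine h g ⟨?_, fun d => (congrArg g (he d)).symm.trans (hg' d)⟩
      ((congrArg g (hr SW)).symm.trans (hg (.endpoint SW)))
      ((congrArg g (hr SE)).symm.trans (hg (.endpoint SE)))
    rintro (⟨c, i⟩ | ⟨j, b⟩ | x)
    exacts [hg (.crossing c i), hg (.joint j b), rfl]

variable {κ : Dart T.Crossing T.Joint Endpoint → Bool}

/-- Alternating endpoint colours are those of the ends of a crossing; which diagonal is over is
dictated by the colour of NW, whose end has the even number `0`. -/
theorem isColoring_outerClosure (h : Diagram.IsColoring T κ)
    (hNE : κ (.endpoint NE) = !κ (.endpoint NW)) (hSE : κ (.endpoint SE) = κ (.endpoint NW))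
    (hSW : κ (.endpoint SW) = !κ (.endpoint NW)) :
    Diagram.IsColoring (T.outerClosure (!κ (.endpoint NW)))
      (κ ∘ (outerEquiv T.Crossing T.Joint).symm) where
  edge d := by
    refine (congrArg κ ((outerEquiv T.Crossing T.Joint).symm_apply_apply _)).trans (h.edge _)
  joint j b := h.joint j b
  crossing c i := by
    rcases c with _ | c
    · change κ (.endpoint (outerEndpoint i)) = (decide (Odd i.val) == !κ (.endpoint NW))
      have : ∀ i : ZMod 4, i = 0 ∨ i = 1 ∨ i = 2 ∨ i = 3 := by decide
      have h0 : decide (Odd (0 : ZMod 4).val) = false := by decide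
      have h1 : decide (Odd (1 : ZMod 4).val) = true := by decide
      have h2 : decide (Odd (2 : ZMod 4).val) = false := by decide
      have h3 : decide (Odd (3 : ZMod 4).val) = true := by decide
      rcases this i with rfl | rfl | rfl | rfl
      · rw [h0, show outerEndpoint 0 = NW from rfl]
        cases κ (.endpoint NW) <;> rfl
      · rw [h1, show outerEndpoint 1 = NE from rfl, hNE]
        cases κ (.endpoint NW) <;> rfl
      · rw [h2, show outerEndpoint 2 = SE from rfl, hSE]
        cases κ (.endpoint NW) <;> rfl
      · rw [h3, show outerEndpoint 3 = SW from rfl, hSW]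
        cases κ (.endpoint NW) <;> rfl
    · exact h.crossing c i

theorem isColoring_numerator (h : Diagram.IsColoring T κ)
    (h1 : κ (.endpoint NE) = !κ (.endpoint NW)) (h2 : κ (.endpoint SE) = !κ (.endpoint SW)) :
    Diagram.IsColoring T.numerator (κ ∘ (numeratorEquiv T.Crossing T.Joint).symm) where
  edge d := (congrArg κ ((numeratorEquiv T.Crossing T.Joint).symm_apply_apply _)).trans (h.edge _)
  joint := by
    rintro (j | (_ | _)) (_ | _)
    · exact h.joint j false
    · exact h.joint j true
    · exact h1
    · exact ((Bool.not_not _).symm.trans (congrArg not h1.symm))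
    · exact h2
    · exact ((Bool.not_not _).symm.trans (congrArg not h2.symm))
  crossing := h.crossing

theorem isColoring_denominator (h : Diagram.IsColoring T κ)
    (h1 : κ (.endpoint SW) = !κ (.endpoint NW)) (h2 : κ (.endpoint SE) = !κ (.endpoint NE)) :
    Diagram.IsColoring T.denominator (κ ∘ (denominatorEquiv T.Crossing T.Joint).symm) where
  edge d :=
    (congrArg κ ((denominatorEquiv T.Crossing T.Joint).symm_apply_apply _)).trans (h.edge _)
  joint := by
    rintro (j | (_ | _)) (_ | _)
    · exact h.joint j false
    · exact h.joint j true
    · exact h1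
    · exact ((Bool.not_not _).symm.trans (congrArg not h1.symm))
    · exact h2
    · exact ((Bool.not_not _).symm.trans (congrArg not h2.symm))
  crossing := h.crossing

/-- Exchange of the upper and of the lower endpoints. -/
def flipHorizontal : Endpoint → Endpoint
  | NW => NE
  | NE => NW
  | SW => SE
  | SE => SW

/-- Exchange of the left and of the right endpoints. -/
def flipVertical : Endpoint → Endpoint
  | NW => SW
  | SW => NW
  | NE => SE
  | SE => NE

theorem numOrbits_numerator_face (T : TangleDiagram) :
    numOrbits {Diagram.rot T flipHorizontal ∘ T.edge} =
      numOrbits {Diagram.rot T.numerator id ∘ T.numerator.edge} := by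
  let e := numeratorEquiv T.Crossing T.Joint
  have hr : ∀ d, e (Diagram.rot T flipHorizontal d) = Diagram.rot T.numerator id (e d) := by
    rintro (⟨c, i⟩ | ⟨j, b⟩ | (_ | _ | _ | _)) <;> rfl
  exact numOrbits_congr_singleton e fun d => (hr _).trans
    (congrArg (fun x => Diagram.rot T.numerator id (e (T.edge x))) (e.symm_apply_apply d).symm)

theorem numOrbits_denominator_face (T : TangleDiagram) :
    numOrbits {Diagram.rot T flipVertical ∘ T.edge} =
      numOrbits {Diagram.rot T.denominator id ∘ T.denominator.edge} := by
  let e := denominatorEquiv T.Crossing T.Joint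
  have hr : ∀ d, e (Diagram.rot T flipVertical d) = Diagram.rot T.denominator id (e d) := by
    rintro (⟨c, i⟩ | ⟨j, b⟩ | (_ | _ | _ | _)) <;> rfl
  exact numOrbits_congr_singleton e fun d => (hr _).trans
    (congrArg (fun x => Diagram.rot T.denominator id (e (T.edge x))) (e.symm_apply_apply d).symm)

/-- If a colouring is compatible with the rotation `ρ` of the endpoints, then `ρ` gives at least as
many faces as the clockwise rotation, provided the two differ by a transposition of endpoints of
distinct colours. -/
theorem numOrbits_face_le_of_coloring (h : Diagram.IsColoring T κ) (ρ : Endpoint → Endpoint)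
    (hρ : ∀ x, κ (.endpoint (ρ x)) = !κ (.endpoint x)) (a b : Endpoint)
    (hab : κ (.endpoint a) ≠ κ (.endpoint b))
    (hcw : ∀ x, ρ x = clockwise x ∨
      ((clockwise x = a ∨ clockwise x = b) ∧ (ρ x = a ∨ ρ x = b))) :
    numOrbits {Diagram.rot T clockwise ∘ T.edge} ≤ numOrbits {Diagram.rot T ρ ∘ T.edge} := by
  have hrot : ∀ d, κ (Diagram.rot T ρ d) = !κ d := by
    rintro (⟨c, i⟩ | ⟨j, b⟩ | x)
    · have : ∀ (o : Bool) (i : ZMod 4),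
        (decide (Odd (i + 1).val) == o) = !(decide (Odd i.val) == o) := by decide
      simp only [Diagram.rot, h.crossing, this]
    · exact h.joint j b
    · exact hρ x
  set S : Set (Dart T.Crossing T.Joint Endpoint → _) := {Diagram.rot T clockwise ∘ T.edge}
  have hS : ∀ d, orbitMk S (Diagram.rot T clockwise (T.edge d)) = orbitMk S d :=
    orbitMk_apply (Set.mem_singleton (Diagram.rot T clockwise ∘ T.edge))
  -- The colour is constant on the faces for `ρ`, so `a` and `b` lie on different ones; the
  -- transposition can merge these but creates no new face.
  refine PreservesUpTo.numOrbits_le (a := .endpoint a) (b := .endpoint b) ?_ ?_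
  · rintro _ rfl d
    have hd := hS d
    rw [Function.comp]
    generalize T.edge d = d' at hd ⊢
    rcases d' with ⟨c, i⟩ | ⟨j, b⟩ | x
    · exact .inl hd
    · exact .inl hd
    · rcases hcw x with hx | ⟨h1, h2⟩
      · left
        rw [← hd]
        simp only [Diagram.rot, hx]
      · right
        rw [← hd]
        simp only [Diagram.rot]
        exact ⟨h1.imp (fun h => by rw [h]) fun h => by rw [h],
          h2.imp (fun h => by rw [h]) fun h => by rw [h]⟩
  · intro hab'
    refine hab (congrArg (Quot.lift κ ?_) hab')
    rintro d _ ⟨_, rfl, rfl⟩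
    rw [Function.comp, hrot, h.edge, Bool.not_not]

/-- The outer closure has one crossing more than the tangle, hence `3` in place of `2`. -/
theorem numOrbits_clockwise_face (hT : T.IsPlanar) {s : T.Crossing → Bool} (hs : T.NumOne s) :
    numOrbits {Diagram.rot T clockwise ∘ T.edge} = Fintype.card T.Crossing + 3 := by
  rw [numOrbits_outerClosure_face T true]
  exact (LinkDiagram.numOrbits_face_eq (isPlanar_outerClosure hT true)
    ((loops_outerClosure_true_iff true s).mpr hs)).trans
      (congrArg (· + 2) (Fintype.card_option (α := T.Crossing)))

/-- The colours alternate around the boundary of the projection disk. -/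
theorem boundary_alternates (hT : T.IsPlanar) (h : Diagram.IsColoring T κ)
    {s t : T.Crossing → Bool} (hs : T.NumOne s) (ht : T.DenOne t) :
    κ (.endpoint NE) = (!κ (.endpoint NW)) ∧ κ (.endpoint SE) = κ (.endpoint NW) ∧
      κ (.endpoint SW) = !κ (.endpoint NW) := by
  have hface := numOrbits_clockwise_face hT hs
  -- Two endpoints have each colour. The nonalternating distributions are then the ones constant on
  -- the left and right sides, excluded by `hnum`, and those constant on the top and bottom,
  -- excluded by `hden`.
  have hsum := Diagram.sum_endpoint_eq_zero T s (fun d => if κ d then (1 : ℤ) else -1)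
    (fun d => by rw [h.edge]; cases κ d <;> simp) (by
      rintro (⟨c, i⟩ | ⟨j, b⟩ | x) hd
      · rw [h.resolve_crossing]
        cases κ (.crossing c i) <;> simp
      · have : κ (Diagram.resolve T s (.joint j b)) = !κ (.joint j b) := h.joint j b
        rw [this]
        cases κ (.joint j b) <;> simp
      · exact absurd rfl (hd x))
  rw [sum_endpoint] at hsum
  have hnum : κ (.endpoint NE) = (!κ (.endpoint NW)) → κ (.endpoint SE) = (!κ (.endpoint SW)) →
      κ (.endpoint NW) ≠ κ (.endpoint SE) → False := by
    intro h1 h2 h3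
    -- Here the numerator would be coloured, with at most `n + 2` faces for `n` crossings of `T`,
    -- but also with at least the `n + 3` faces of the outer closure.
    have h4 := numOrbits_face_le_of_coloring h flipHorizontal (by
      rintro (_ | _ | _ | _)
      exacts [h1, by simp [flipHorizontal, h1], by simp [flipHorizontal, h2], h2]) NW SE h3 (by
      rintro (_ | _ | _ | _) <;> simp [flipHorizontal, clockwise])
    have h5 : numOrbits {Diagram.rot T.numerator id ∘ T.numerator.edge} ≤
        Fintype.card T.Crossing + 2 :=
      (LinkDiagram.numOrbits_face_le_of_loops_eq_one (isColoring_numerator h h1 h2)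
        ((loops_numerator_eq_one_iff T s).mpr hs)).1
    rw [← numOrbits_numerator_face] at h5
    omega
  have hden : κ (.endpoint SW) = (!κ (.endpoint NW)) → κ (.endpoint SE) = (!κ (.endpoint NE)) →
      κ (.endpoint NE) ≠ κ (.endpoint SW) → False := by
    intro h1 h2 h3
    have h4 := numOrbits_face_le_of_coloring h flipVertical (by
      rintro (_ | _ | _ | _)
      exacts [h1, h2, by simp [flipVertical, h2], by simp [flipVertical, h1]]) NE SW h3 (by
      rintro (_ | _ | _ | _) <;> simp [flipVertical, clockwise])
    have h5 : numOrbits {Diagram.rot T.denominator id ∘ T.denominator.edge} ≤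
        Fintype.card T.Crossing + 2 :=
      (LinkDiagram.numOrbits_face_le_of_loops_eq_one (isColoring_denominator h h1 h2)
        ((loops_denominator_eq_one_iff T t).mpr ht)).1
    rw [← numOrbits_denominator_face] at h5
    omega
  revert hsum hnum hden
  generalize κ (.endpoint NW) = a
  generalize κ (.endpoint NE) = b
  generalize κ (.endpoint SE) = c
  generalize κ (.endpoint SW) = d
  revert a b c d
  decide

/-- Both states extend to one-circle states of the coloured outer closure, which have equal weights;
the opposite smoothings at the outer crossing account for the difference `±2`. -/
theorem weight_eq_of_numOne_of_denOne (hT : T.IsPlanar) (h : Diagram.IsColoring T κ)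
    {s t : T.Crossing → Bool} (hs : T.NumOne s) (ht : T.DenOne t) :
    weight s = weight t + (if κ (.endpoint NW) then 2 else -2) := by
  obtain ⟨h1, h2, h3⟩ := boundary_alternates hT h hs ht
  have := LinkDiagram.weight_eq_of_isColoring (isPlanar_outerClosure hT _)
    (isColoring_outerClosure h h1 h2 h3) ((loops_outerClosure_true_iff _ s).mpr hs)
    ((loops_outerClosure_false_iff _ t).mpr ht)
  have := (weight_outerState _ s).symm.trans (this.trans (weight_outerState _ t))
  revert this
  cases κ (.endpoint NW) <;> simp <;> intros <;> linarith

end TangleDiagram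

/-! ### Alternating tangles: colouring, tameness and phase -/

theorem Diagram.Leads.eq_of_edge {E : Type} {D : Diagram E} {x d : Dart D.Crossing D.Joint E}
    (h : D.Leads x (D.edge d)) : d = x ∨ ∃ j b, d = .joint j b := by
  generalize hd : D.edge d = d' at h
  have inj : ∀ {a b}, D.edge a = D.edge b → a = b := fun {a b} h => by
    rw [← D.edge_edge a, h, D.edge_edge]
  cases h with
  | edge => exact .inl (inj hd)
  | through j b h => exact .inr ⟨_, _, inj hd⟩

namespace TangleDiagram

open Endpoint

variable {T : TangleDiagram}

theorem eq_of_leads {s : T.Crossing → Bool} {g : Dart T.Crossing T.Joint Endpoint → Bool}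
    (hg : g ∈ T.invariants s) {d d' : Dart T.Crossing T.Joint Endpoint} (h : T.Leads d d') :
    g d' = g d := by
  induction h with
  | edge => exact hg.2 d
  | through j b _ ih => rw [hg.2, ← ih]; exact hg.1 (.joint j b)

/-- A strand without crossings does not return to the endpoint at which it starts. -/
theorem not_leads_self (x : Endpoint)
    (hx : ∀ c i, ¬ T.Leads (.endpoint x) (.crossing c i)) :
    ¬ T.Leads (.endpoint x) (.endpoint x) := by
  classical
  intro h
  -- The indicator of all darts on the strand is invariant and would be nonzero at the endpoint `x`
  -- alone, against parity.
  let g : Dart T.Crossing T.Joint Endpoint → Bool := fun d =>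
    decide (T.Leads (.endpoint x) d ∨ T.Leads (.endpoint x) (T.edge d))
  have hgc : ∀ c i, g (.crossing c i) = false := by
    intro c i
    refine decide_eq_false ?_
    rintro (h | h)
    · exact hx c i h
    · rcases h.eq_of_edge with h | ⟨j, b, h⟩ <;> cases h
  have hj : ∀ j b, T.Leads (.endpoint x) (.joint j b) ∨
      T.Leads (.endpoint x) (T.edge (.joint j b)) →
      T.Leads (.endpoint x) (.joint j (!b)) ∨ T.Leads (.endpoint x) (T.edge (.joint j (!b))) := by
    rintro j b (h | h)
    · exact .inr h.through
    · exact .inl (h.edge_of_joint (by simp))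
  have hg : g ∈ T.invariants fun _ => true := by
    refine ⟨?_, fun d => ?_⟩
    · rintro (⟨c, i⟩ | ⟨j, b⟩ | y)
      · exact (hgc _ _).trans (hgc _ _).symm
      · refine decide_eq_decide.mpr ⟨fun h => ?_, hj j b⟩
        simpa using hj j (!b) h
      · rfl
    · refine decide_eq_decide.mpr ?_
      rw [T.edge_edge, or_comm]
  have hge : ∀ y, g (.endpoint y) = decide (y = x) := by
    intro y
    refine decide_eq_decide.mpr ⟨?_, ?_⟩
    · rintro (hy | hy)
      · have := hy.symm.source_unique (by simp) (by simp) h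
        simpa using this
      · rcases hy.eq_of_edge with h | ⟨j, b, h⟩
        · simpa using h
        · cases h
    · rintro rfl
      exact .inl h
  have := (T.isBoundaryAlgebra_invariants _).parity g hg
  simp only [hge] at this
  revert this
  cases x <;> decide

/-- An alternating tangle diagram has a colouring if the numerator closure of some state is one
circle and the strands that start at NW and NE do not join them without crossings. -/
theorem exists_isColoring (hT : T.IsAlternating) {s : T.Crossing → Bool} (hs : T.NumOne s)
    (hne : ¬ T.Leads (.endpoint NW) (.endpoint NE)) : ∃ κ, Diagram.IsColoring T κ := by
  classical
  -- A crossing-free strand from NW or NE gets its colour by choice, here `true` at that endpoint.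
  -- This is consistent unless the strand joins the two, which `hne` excludes.
  let P : Endpoint → Prop := fun x =>
    (x = NW ∨ x = NE) ∧ ∀ c i, ¬ T.Leads (.endpoint x) (.crossing c i)
  obtain ⟨κ, h1, h2, h3⟩ := Diagram.exists_coloring_of_labels (D := T)
    (lab := Diagram.overLabel T)
    (Y := {d | (∃ c i, d = .crossing c i) ∨ ∃ x, P x ∧ d = .endpoint x})
    (by rintro _ (⟨c, i, rfl⟩ | ⟨x, -, rfl⟩) <;> simp) (by
      rintro _ (⟨c, i, rfl⟩ | ⟨x, ⟨hx, hx'⟩, rfl⟩) _ (⟨c', i', rfl⟩ | ⟨y, ⟨hy, hy'⟩, rfl⟩) hl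
      · exact hT.overLabel_eq hl
      · exact absurd hl.symm (hy' _ _)
      · exact absurd hl (hx' _ _)
      · rcases hx with rfl | rfl <;> rcases hy with rfl | rfl
        · exact absurd hl (not_leads_self _ hx')
        · exact absurd hl hne
        · exact absurd hl.symm hne
        · exact absurd hl (not_leads_self _ hx')) (by
      intro p hp he hj
      have hc : ∀ c i, p (.crossing c i) := fun c i => hp _ (.inl ⟨c, i, rfl⟩)
      have hg : (fun d => decide (p d)) ∈ T.invariants s := by
        refine ⟨?_, fun d => decide_eq_decide.mpr
          ⟨fun h => by simpa [T.edge_edge] using he _ h, he d⟩⟩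
        rintro (⟨c, i⟩ | ⟨j, b⟩ | x)
        · exact decide_eq_decide.mpr ⟨fun _ => hc _ _, fun _ => hc _ _⟩
        · exact decide_eq_decide.mpr ⟨fun h => by simpa using hj _ _ h, hj j b⟩
        · rfl
      have hx : ∀ x, x = NW ∨ x = NE → p (.endpoint x) := by
        intro x hx
        by_cases hcr : ∃ c i, T.Leads (.endpoint x) (.crossing c i)
        · obtain ⟨c, i, hl⟩ := hcr
          have := eq_of_leads hg hl
          simpa [hc] using this
        · exact hp _ (.inr ⟨x, ⟨hx, fun c i h => hcr ⟨c, i, h⟩⟩, rfl⟩)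
      have hNW := hx NW (.inl rfl)
      have hNE := hx NE (.inr rfl)
      have hpar := (T.isBoundaryAlgebra_invariants s).parity _ hg
      intro d
      -- The set of reached darts contains NW and NE, so by parity it contains both or neither of SE
      -- and SW; the one-circle numerator then forces it to be everything.
      have := hs _ hg (by simp [hNW, hNE]) (by
        revert hpar
        simp only [hNW, hNE]
        cases decide (p (.endpoint SE)) <;> cases decide (p (.endpoint SW)) <;> decide) d
        (.endpoint NW)
      simpa [hNW] using this)
  exact ⟨κ, h1, h2, fun c i => h3 _ (.inl ⟨c, i, rfl⟩)⟩

/-- A disconnected diagram has a separating function, which is constant on the components of all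
states. -/
theorem exists_invariant_of_not_isConnected (hT : ¬ Diagram.IsConnected T) :
    ∃ g : Dart T.Crossing T.Joint Endpoint → Bool, (∀ s, g ∈ T.invariants s) ∧
      ∃ x y, g x ≠ g y := by
  have hne : Nonempty (Dart T.Crossing T.Joint Endpoint) := ⟨.endpoint NW⟩
  rw [Diagram.IsConnected, numOrbits_pair_eq_one_iff] at hT
  push Not at hT
  obtain ⟨g, h1, h2, hxy⟩ := hT
  refine ⟨g, fun s => ⟨?_, h2⟩, hxy⟩
  rintro (⟨c, i⟩ | ⟨j, b⟩ | x)
  · have h : ∀ i, g (.crossing c (i + 1)) = g (.crossing c i) := fun i => h1 (.crossing c i)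
    simp only [Diagram.resolve, Diagram.partner]
    split_ifs
    · exact h i
    · rw [← h, sub_add_cancel]
  · exact h1 (.joint j b)
  · rfl

/-- Equality at NW and NE implies equality at SW and SE by parity, and the function would descend to
the single circle of the numerator. -/
theorem invariant_NW_ne_NE {s : T.Crossing → Bool} (hs : T.NumOne s)
    {g : Dart T.Crossing T.Joint Endpoint → Bool} (hg : g ∈ T.invariants s)
    (hxy : ∃ x y, g x ≠ g y) : g (.endpoint NW) ≠ g (.endpoint NE) := by
  intro h
  obtain ⟨x, y, hxy⟩ := hxy
  refine hxy (hs g hg h ?_ x y)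
  have := (T.isBoundaryAlgebra_invariants s).parity g hg
  revert this
  rw [h]
  cases g (.endpoint NE) <;> cases g (.endpoint SE) <;> cases g (.endpoint SW) <;> decide

/-- A state with one circle in both closures would have a weight differing by 2 from itself. A
connected `T` is coloured from the crossing supplied by type 1; for a disconnected one the
separating function prevents a crossing-free strand from NW to NE. -/
theorem isTame_of_isAlternating (hp : T.IsPlanar) (ha : T.IsAlternating)
    (h1 : Diagram.IsConnected T → T.IsType1) : T.IsTame := by
  rintro s ⟨hs, ht⟩
  obtain ⟨κ, hκ⟩ : ∃ κ, Diagram.IsColoring T κ := by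
    by_cases hc : Diagram.IsConnected T
    · obtain ⟨c, -⟩ := h1 hc
      exact Diagram.IsAlternating.exists_isColoring ha hc c
    · obtain ⟨g, hg, hxy⟩ := exists_invariant_of_not_isConnected hc
      refine exists_isColoring ha hs fun hl => ?_
      exact invariant_NW_ne_NE hs (hg s) hxy (eq_of_leads (hg s) hl).symm
  have := weight_eq_of_numOne_of_denOne hp hκ hs ht
  split_ifs at this <;> omega

/-- A separating function takes different values at NW and NE because of `s`, but equal ones because
of `t`. Thus type 1 is available whenever both brackets have contributing states. -/
theorem isConnected_of_numOne_of_denOne (hT : T.IsTame) {s t : T.Crossing → Bool}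
    (hs : T.NumOne s) (ht : T.DenOne t) : Diagram.IsConnected T := by
  by_contra hc
  obtain ⟨g, hg, hxy⟩ := exists_invariant_of_not_isConnected hc
  refine invariant_NW_ne_NE hs (hg s) hxy ?_
  exact (((T.isBoundaryAlgebra_invariants t).boundary_of_closesUp (hT t) ht).2 g (hg t)).1

/-- The brackets of the closures of an alternating tangle diagram of type 1 differ by the phase
`i`. -/
theorem exists_phase (hp : T.IsPlanar) (ha : T.IsAlternating)
    (h1 : Diagram.IsConnected T → T.IsType1) :
    ∃ v : ℂ, ‖v‖ = 1 ∧ T.numBracket = Complex.I * v * ‖T.numBracket‖ ∧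
      T.denBracket = v * ‖T.denBracket‖ := by
  classical
  have hphase : ∀ z : ℂ, ∃ v : ℂ, ‖v‖ = 1 ∧ z = v * ‖z‖ := by
    intro z
    by_cases hz : z = 0
    · exact ⟨1, norm_one, by simp [hz]⟩
    · have : (‖z‖ : ℂ) ≠ 0 := by exact_mod_cast norm_ne_zero_iff.mpr hz
      exact ⟨z / ‖z‖, by simp [hz], by rw [div_mul_cancel₀ _ this]⟩
  by_cases hN : ∃ s, T.NumOne s
  swap
  · have h0 : T.numBracket = 0 := by
      rw [numBracket_eq]
      exact Finset.sum_eq_zero fun s _ => if_neg fun h => hN ⟨s, h⟩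
    obtain ⟨v, hv, h⟩ := hphase T.denBracket
    exact ⟨v, hv, by simp [h0], h⟩
  by_cases hD : ∃ t, T.DenOne t
  swap
  · have h0 : T.denBracket = 0 := by
      rw [denBracket_eq]
      exact Finset.sum_eq_zero fun s _ => if_neg fun h => hD ⟨s, h⟩
    obtain ⟨v, hv, h⟩ := hphase T.numBracket
    -- If one bracket vanishes, the phase is dictated by the other alone; the factor `-i` cancels
    -- the `i` of the numerator.
    refine ⟨-Complex.I * v, by simp [hv], ?_, by simp [h0]⟩
    linear_combination h + v * ‖T.numBracket‖ * Complex.I_mul_I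
  obtain ⟨s₀, hs₀⟩ := hN
  obtain ⟨t₀, ht₀⟩ := hD
  have hc := isConnected_of_numOne_of_denOne (isTame_of_isAlternating hp ha h1) hs₀ ht₀
  obtain ⟨c, i, hl, hci⟩ := h1 hc
  obtain ⟨κ, hκ⟩ := Diagram.IsAlternating.exists_isColoring ha hc c
  -- The colour changes along the strand from NW to its first crossing, where it is `false` by type
  -- 1.
  have hNW : κ (.endpoint NW) = true := by
    have h2 := hκ.leads hl
    rw [← Diagram.overLabel_eq_true_iff] at hci
    have h3 : κ (.crossing c i) = Diagram.overLabel T (.crossing c i) := hκ.crossing c i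
    rw [h3] at h2
    cases h : κ (.endpoint NW)
    · rw [h] at h2
      exact absurd h2 hci
    · rfl
  have hw : ∀ s t, T.NumOne s → T.DenOne t → weight s = weight t + 2 := by
    intro s t hs ht
    have := weight_eq_of_numOne_of_denOne hp hκ hs ht
    rwa [if_pos hNW] at this
  have hne : Nonempty (Dart T.numerator.Crossing T.numerator.Joint Empty) :=
    ⟨.joint (.inr true) true⟩
  have hne' : Nonempty (Dart T.denominator.Crossing T.denominator.Joint Empty) :=
    ⟨.joint (.inr true) true⟩
  obtain ⟨N, hN⟩ := LinkDiagram.bracket_rootA_of_weight_eq T.numerator (k := weight t₀ + 2)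
    fun s hs => hw s t₀ ((loops_numerator_eq_one_iff T s).mp hs) ht₀
  obtain ⟨M, hM⟩ := LinkDiagram.bracket_rootA_of_weight_eq T.denominator (k := weight t₀)
    fun t ht => by
      have h2 := hw s₀ t hs₀ ((loops_denominator_eq_one_iff T t).mp ht)
      have h3 := hw s₀ t₀ hs₀ ht₀
      exact add_right_cancel (h2.symm.trans h3)
  have hN : T.numBracket = N * rootA ^ (weight t₀ + 2) := hN
  have hM : T.denBracket = M * rootA ^ weight t₀ := hM
  refine ⟨rootA ^ weight t₀, norm_rootA_zpow _, ?_, ?_⟩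
  · have : ‖T.numBracket‖ = N := by rw [hN, norm_mul, norm_rootA_zpow, mul_one, Complex.norm_natCast]
    rw [this, hN, zpow_add₀ rootA_ne_zero, show rootA ^ (2 : ℤ) = Complex.I from rootA_sq]
    push_cast
    ring
  · have : ‖T.denBracket‖ = M := by rw [hM, norm_mul, norm_rootA_zpow, mul_one, Complex.norm_natCast]
    rw [this, hM]
    push_cast
    ring

theorem det_numerator_add {R : TangleDiagram} {p : ℤ} {q : ℕ} (hR : HasFraction R p q)
    (hp : T.IsPlanar) (ha : T.IsAlternating) (h1 : Diagram.IsConnected T → T.IsType1) :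
    LinkDiagram.det (R.add T).numerator =
      |q * LinkDiagram.det T.numerator + p * LinkDiagram.det T.denominator| := by
  obtain ⟨ht, u, hu, hRn, hRd⟩ := hR
  obtain ⟨v, hv, hTn, hTd⟩ := exists_phase hp ha h1
  rw [det_numerator, det_numerator, det_denominator,
    numBracket_add ht (isTame_of_isAlternating hp ha h1), hRn, hRd]
  -- Both summands carry the phase `i u v`, so the real factor is a signed sum and a negative `p`
  -- produces the difference.
  have : (q : ℤ) * u * T.numBracket + Complex.I * p * u * T.denBracket =
      ((q * ‖T.numBracket‖ + p * ‖T.denBracket‖ : ℝ) : ℂ) * (Complex.I * u * v) := by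
    conv_lhs => rw [hTn, hTd]
    push_cast
    ring
  rw [this, norm_mul, norm_mul, norm_mul, hu, hv, Complex.norm_I, Complex.norm_real,
    Real.norm_eq_abs]
  ring

end TangleDiagram

theorem mainTheorem10 :
    (∀ (D : LinkDiagram) (c : D.Crossing), LinkDiagram.IsPlanar D →
      LinkDiagram.IsDealternator D c →
        LinkDiagram.det D =
          |LinkDiagram.det (D.smoothZero c) - LinkDiagram.det (D.smoothInfty c)|) ∧
    (∀ (T : TangleDiagram), TangleDiagram.IsPlanar T → T.IsAlternating →
      (T.IsConnected → TangleDiagram.IsType1 T) →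
      ∀ (α β : ℕ), 0 < α → 0 < β → Nat.Coprime α β →
        (∀ as : List ℤ, IsStandardExpansion ((α : ℚ) / (β : ℚ)) as →
          LinkDiagram.det
              (TangleDiagram.numerator (TangleDiagram.add (TangleDiagram.rational as) T)) =
            β * LinkDiagram.det (TangleDiagram.numerator T) +
              α * LinkDiagram.det (TangleDiagram.denominator T)) ∧
        (∀ as : List ℤ, IsStandardExpansion (-((α : ℚ) / (β : ℚ))) as →
          LinkDiagram.det
              (TangleDiagram.numerator (TangleDiagram.add (TangleDiagram.rational as) T)) =
            |β * LinkDiagram.det (TangleDiagram.numerator T) -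
              α * LinkDiagram.det (TangleDiagram.denominator T)|)) := by
  refine ⟨fun D c hD hc => LinkDiagram.det_of_isDealternator D c hD hc, ?_⟩
  intro T hp ha h1 α β hα hβ hαβ
  have hcop : IsCoprime (α : ℤ) (β : ℤ) := Nat.isCoprime_iff_coprime.mpr hαβ
  constructor
  · intro as has
    have hR := TangleDiagram.hasFraction_rational (p := α) (as := as) hβ hcop
      (by rw [Int.cast_natCast]; exact has)
    rw [TangleDiagram.det_numerator_add hR hp ha h1, abs_of_nonneg]
    · simp
    · have h2 : 0 ≤ LinkDiagram.det T.numerator := norm_nonneg _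
      have h3 : 0 ≤ LinkDiagram.det T.denominator := norm_nonneg _
      push_cast
      positivity
  · intro as has
    have hR := TangleDiagram.hasFraction_rational (p := -α) (as := as) hβ hcop.neg_left
      (by rw [Int.cast_neg, Int.cast_natCast, neg_div]; exact has)
    rw [TangleDiagram.det_numerator_add hR hp ha h1]
    push_cast
    rw [neg_mul, ← sub_eq_add_neg]
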